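/- Theorem. Let $n,m\in\mathbb N$, let $\mathbb R^n$ and $\mathbb R^m$ carry the Euclidean norm, let $\mathcal U := L^\infty(\mathbb R_+,\mathbb R^m)$ with the essential supremum norm $\|\cdot\|_{\mathcal U}$, and let $f:\mathbb R^n\times\mathbb R^m\to\mathbb R^n$ be jointly Lipschitz on bounded sets: for each $C>0$ there is $L_C>0$ such that $$\|f(x_1,u_1)-f(x_2,u_2)\|\le L_C\big(\|x_1-x_2\|+\|u_1-u_2\|\big)\quad\text{whenever }\|x_1\|,\|x_2\|,\|u_1\|,\|u_2\|<C.$$ For $x\in\mathbb R^n$ and $u\in\mathcal U$ let $t\mapsto\phi(t,x,u)$ denote the maximal Carathéodory solution of $\dot x(t)=f(x(t),u(t))$, $t\ge 0$, with $x(0)=x$. Let $\mathcal K_\infty$ be the set of continuous, strictly increasing, unbounded functions $\gamma:\mathbb R_+\to\mathbb R_+$ with $\gamma(0)=0$. The following statements are equivalent. 1. (Forward completeness.) $\phi(t,x,u)$ is defined for all $x\in\mathbb R^n$, $u\in\mathcal U$ and $t\ge0$. 2. (Bounded reachability sets, BRS.) The system is forward complete, and for all $C>0$ and $\tau\ge0$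 $$\sup_{\|x\|<C,\ \|u\|_{\mathcal U}<C,\ 0\le t<\tau}\|\phi(t,x,u)\|<\infty .$$ 3. There exists a BRS Lyapunov function, that is, a continuous function $V:\mathbb R^n\to\mathbb R_+$ such that (a) there are $\alpha_1,\alpha_2\in\mathcal K_\infty$ and $C\ge0$ with $\alpha_1(\|x\|)\le V(x)\le\alpha_2(\|x\|)+C$ for all $x\in\mathbb R^n$; (b) there is $\chi\in\mathcal K_\infty$ such that for all $x\in\mathbb R^n$ and $u\in\mathcal U$ $$\chi(\|u\|_{\mathcal U})\le\|x\|\ \Longrightarrow\ \dot V_u(x):=\limsup_{s\downarrow0}\tfrac1s\big(V(\phi(s,x,u))-V(x)\big)\le V(x).$$ 4. There exists a BRS Lyapunov function that is Lipschitz continuous on bounded sets, that is, for each $C>0$ there is $L>0$ with $|V(x_1)-V(x_2)|\le L\|x_1-x_2\|$ whenever $\|x_1\|,\|x_2\|<C$. 5. (Robust forward completeness with respect to trajectory-dominated inputs.) The system is forward complete, and there exists $\eta\in\mathcal K_\infty$ such that for all $C>0$ and $\tau\ge0$ $$\sup_{\|x\|<C,\ u\in\mathcal U_x^\eta,\ 0\le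 t<\tau}\|\phi(t,x,u)\|<\infty,$$ where $\mathcal U_x^\eta:=\{v\in\mathcal U:\ \|v(\theta)\|\le\eta(\|\phi(\theta,x,v)\|)\text{ for a.e. }\theta\ge0\}$. No a priori bound on the magnitude of the inputs is imposed. -/

import Mathlib

open MeasureTheory Set Filter Topology
open scoped NNReal ENNReal

noncomputable section

/-- Class `𝒫`: continuous `γ : ℝ₊ → ℝ₊` with `γ 0 = 0` and `γ s > 0` for `s > 0`. -/
structure ClassP (γ : ℝ≥0 → ℝ≥0) : Prop where
  map_zero : γ 0 = 0
  continuous : Continuous γ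
  pos : ∀ s, 0 < s → 0 < γ s

/-- Class `𝒦`: strictly increasing functions of class `𝒫`. -/
structure ClassK (γ : ℝ≥0 → ℝ≥0) : Prop extends ClassP γ where
  strictMono : StrictMono γ

/-- Class `𝒦_∞`: unbounded functions of class `𝒦`. -/
structure ClassKInfty (γ : ℝ≥0 → ℝ≥0) : Prop extends ClassK γ where
  unbounded : ¬ BddAbove (range γ)

/-- The state space `ℝⁿ` with the Euclidean norm. -/
abbrev StateSpace (n : ℕ) := EuclideanSpace ℝ (Fin n)

/-- The space of input values `ℝᵐ` with the Euclidean norm. -/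
abbrev InputValue (m : ℕ) := EuclideanSpace ℝ (Fin m)

/-- The input space `L^∞(ℝ₊, ℝᵐ)` with the essential supremum norm. -/
abbrev Input (m : ℕ) := Lp (InputValue m) ∞ (volume.restrict (Ici (0 : ℝ)))

/-- Joint Lipschitz continuity on bounded sets of the right-hand side `f(x, u)`. -/
def JointlyLipschitzOnBoundedSets {n m : ℕ}
    (f : StateSpace n → InputValue m → StateSpace n) : Prop :=
  ∀ C : ℝ, 0 < C → ∃ L : ℝ, 0 < L ∧
    ∀ x₁ x₂ : StateSpace n, ∀ u₁ u₂ : InputValue m,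
      ‖x₁‖ < C → ‖x₂‖ < C → ‖u₁‖ < C → ‖u₂‖ < C →
        ‖f x₁ u₁ - f x₂ u₂‖ ≤ L * (‖x₁ - x₂‖ + ‖u₁ - u₂‖)

/-- Lipschitz continuity on bounded sets of a function `V : ℝⁿ → ℝ₊`. -/
def LipschitzOnBoundedSets {n : ℕ} (V : StateSpace n → ℝ≥0) : Prop :=
  ∀ C : ℝ, 0 < C → ∃ L : ℝ, 0 < L ∧
    ∀ x₁ x₂ : StateSpace n, ‖x₁‖ < C → ‖x₂‖ < C →
      |(V x₁ : ℝ) - (V x₂ : ℝ)| ≤ L * ‖x₁ - x₂‖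

/-- `ξ` is, on `[0, t]`, a Carathéodory solution of `ẋ = f(x, u)`, `x(0) = x₀`, that is, a
continuous solution of the integral equation `ξ(s) = x₀ + ∫₀ˢ f(ξ(r), u(r)) dr`. -/
structure IsSolutionUpTo {n m : ℕ} (f : StateSpace n → InputValue m → StateSpace n)
    (x₀ : StateSpace n) (u : Input m) (t : ℝ) (ξ : ℝ → StateSpace n) : Prop where
  continuousOn : ContinuousOn ξ (Icc 0 t)
  intervalIntegrable : IntervalIntegrable (fun r => f (ξ r) (u r)) volume 0 t
  integral_eq : ∀ s ∈ Icc 0 t, ξ s = x₀ + ∫ r in (0 : ℝ)..s, f (ξ r) (u r)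

/-- The maximal interval of existence: all `t ≥ 0` for which a solution exists on `[0, t]`. -/
def maximalDomain {n m : ℕ} (f : StateSpace n → InputValue m → StateSpace n)
    (x : StateSpace n) (u : Input m) : Set ℝ :=
  {t | 0 ≤ t ∧ ∃ ξ : ℝ → StateSpace n, IsSolutionUpTo f x u t ξ}

open Classical in
/-- The transition map `φ(t, x, u)` of `ẋ = f(x, u)`: the value at time `t` of the solution with
initial value `x` and input `u`, for `t` in the maximal interval of existence. (Solutions are
unique when `f` is jointly Lipschitz on bounded sets; outside the maximal interval the value is
irrelevant and set to `0`.) -/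
def flow {n m : ℕ} (f : StateSpace n → InputValue m → StateSpace n)
    (t : ℝ) (x : StateSpace n) (u : Input m) : StateSpace n :=
  if h : ∃ ξ : ℝ → StateSpace n, IsSolutionUpTo f x u t ξ then h.choose t else 0

/-- Forward completeness: `φ(t, x, u)` is well-defined for all `t ≥ 0` and all `x`, `u`. -/
def ForwardComplete {n m : ℕ} (f : StateSpace n → InputValue m → StateSpace n) : Prop :=
  ∀ (x : StateSpace n) (u : Input m) (t : ℝ), 0 ≤ t → t ∈ maximalDomain f x u

/-- Bounded reachability sets (BRS). -/
def HasBRS {n m : ℕ} (f : StateSpace n → InputValue m → StateSpace n) : Prop :=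
  ForwardComplete f ∧
    ∀ C τ : ℝ, 0 < C → 0 ≤ τ →
      BddAbove {r : ℝ | ∃ (x : StateSpace n) (u : Input m) (t : ℝ),
        ‖x‖ < C ∧ ‖u‖ < C ∧ 0 ≤ t ∧ t < τ ∧ r = ‖flow f t x u‖}

/-- The set `𝒰_x^η` of trajectory-dominated inputs with respect to the initial value `x` and the
growth margin `η`. -/
def trajectoryDominatedInputs {n m : ℕ} (f : StateSpace n → InputValue m → StateSpace n)
    (η : ℝ≥0 → ℝ≥0) (x : StateSpace n) : Set (Input m) :=
  {v | ∀ᵐ θ ∂(volume.restrict (Ici (0 : ℝ))), ‖v θ‖₊ ≤ η ‖flow f θ x v‖₊}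

/-- Robust forward completeness with respect to trajectory-dominated inputs. -/
def RobustlyForwardCompleteTDI {n m : ℕ}
    (f : StateSpace n → InputValue m → StateSpace n) : Prop :=
  ForwardComplete f ∧
    ∃ η : ℝ≥0 → ℝ≥0, ClassKInfty η ∧
      ∀ C τ : ℝ, 0 < C → 0 ≤ τ →
        BddAbove {r : ℝ | ∃ (x : StateSpace n) (u : Input m) (t : ℝ),
          ‖x‖ < C ∧ u ∈ trajectoryDominatedInputs f η x ∧ 0 ≤ t ∧ t < τ ∧
            r = ‖flow f t x u‖}

/-- The Lie derivative of `V` at `x` along `ẋ = f(x, u)`: the upper right-hand Dini derivative of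
`t ↦ V (φ(t, x, u))` at `0`, with values in the extended reals. -/
def lieDerivative {n m : ℕ} (f : StateSpace n → InputValue m → StateSpace n)
    (V : StateSpace n → ℝ≥0) (u : Input m) (x : StateSpace n) : EReal :=
  limsup (fun s : ℝ => ((((V (flow f s x u) : ℝ) - (V x : ℝ)) / s : ℝ) : EReal)) (𝓝[>] (0 : ℝ))

/-- BRS Lyapunov functions. -/
structure IsBRSLyapunovFunction {n m : ℕ}
    (f : StateSpace n → InputValue m → StateSpace n) (V : StateSpace n → ℝ≥0) : Prop where
  continuous : Continuous V
  sandwich : ∃ α₁ α₂ : ℝ≥0 → ℝ≥0, ClassKInfty α₁ ∧ ClassKInfty α₂ ∧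
    ∃ C : ℝ≥0, ∀ x : StateSpace n, α₁ ‖x‖₊ ≤ V x ∧ V x ≤ α₂ ‖x‖₊ + C
  growth : ∃ χ : ℝ≥0 → ℝ≥0, ClassKInfty χ ∧
    ∀ (x : StateSpace n) (u : Input m), χ ‖u‖₊ ≤ ‖x‖₊ →
      lieDerivative f V u x ≤ ((V x : ℝ) : EReal)

end

/-! The implications 1 → 2 → 4 → 3 → 1 form a cycle, and 2 → 5 → 1 attaches the last statement to
it. The substantial ones are 1 → 2 and 2 → 4.

1 → 2 (`not_unboundedReachNear`). If a reachability set is unbounded, compactness gives a point near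
which trajectories become arbitrarily large in bounded time. These trajectories cross every larger
sphere; a limit point of first crossing points has the same bad property with essentially the
remaining time. Backward continuous dependence lets some trajectory starting close by land exactly
on that limit point. The iteration therefore concatenates inputs and moves the initial state
slightly, inside nested closed balls. A point of the intersection, driven by the glued input,
exceeds every bound before a fixed time, which contradicts continuity of a global solution.

2 → 4 and 2 → 5. Choose radii `R k` such that one unit of time, with inputs of size at most `R k`,
leads from the ball of radius `R k` at most to that of radius `R (k + 1)`. A slowly growing `η` of
class `𝒦_∞` counts these levels. Even inputs with `‖u‖ ≤ 1 + η(‖ξ‖)` raise the level by at most one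
per unit of time (`IsDominatedSolution.level_le`), which already yields 5. Set `V(x) = 2 + sup
(η(‖ξ(t)‖) - 2t)` over dominated solutions from `x`. The rate 2 exceeds the growth rate 1, so the
supremum is finite and times beyond 3 can be ignored, which gives the Lipschitz bound. Concatenation
gives growth of `V` at rate at most 2, and `2 ≤ V`.

3 → 1. Outside a ball depending on the input, `V` grows at most exponentially along solutions;
properness of `V` gives an a priori bound and hence existence. -/

section Basics

variable {n m : ℕ}

/-! ### Inputs -/

theorem ae_norm_le_norm_input (u : Input m) :
    ∀ᵐ r ∂(volume.restrict (Ici (0 : ℝ))), ‖u r‖ ≤ ‖u‖ := by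
  have h := enorm_ae_le_eLpNormEssSup (u : ℝ → InputValue m) (volume.restrict (Ici (0 : ℝ)))
  filter_upwards [h] with r hr
  rw [Lp.norm_def, eLpNorm_exponent_top, ← toReal_enorm]
  refine ENNReal.toReal_mono ?_ hr
  have := Lp.eLpNorm_ne_top u
  rwa [eLpNorm_exponent_top] at this

theorem ae_restrict_Icc_of_ae_restrict_Ici {p : ℝ → Prop}
    (h : ∀ᵐ r ∂(volume.restrict (Ici (0 : ℝ))), p r) {a : ℝ} (ha : 0 ≤ a) (b : ℝ) :
    ∀ᵐ r ∂(volume.restrict (Icc a b)), p r :=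
  ae_restrict_of_ae_restrict_of_subset (fun _ hr => ha.trans hr.1) h

theorem exists_input {w : ℝ → InputValue m} {c : ℝ} (hc : 0 ≤ c)
    (hw : AEStronglyMeasurable w (volume.restrict (Ici (0 : ℝ))))
    (hb : ∀ᵐ r ∂(volume.restrict (Ici (0 : ℝ))), ‖w r‖ ≤ c) :
    ∃ v : Input m, (∀ᵐ r ∂(volume.restrict (Ici (0 : ℝ))), v r = w r) ∧ ‖v‖ ≤ c := by
  have hm : MemLp w ∞ (volume.restrict (Ici (0 : ℝ))) := memLp_top_of_bound hw c hb
  refine ⟨hm.toLp w, hm.coeFn_toLp, ?_⟩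
  rw [Lp.norm_toLp, eLpNorm_exponent_top]
  refine ENNReal.toReal_le_of_le_ofReal hc ?_
  refine essSup_le_of_ae_le _ ?_
  filter_upwards [hb] with r hr
  rw [← ofReal_norm]
  exact ENNReal.ofReal_le_ofReal hr

/-! ### Integral inequalities -/

theorem le_mul_exp_of_le_add_integral {v : ℝ → ℝ} {t δ L : ℝ} (hL : 0 ≤ L)
    (hv : ContinuousOn v (Icc 0 t))
    (h : ∀ s ∈ Icc 0 t, v s ≤ δ + L * ∫ r in (0 : ℝ)..s, v r) :
    ∀ s ∈ Icc 0 t, v s ≤ δ * Real.exp (L * s) := by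
  intro s hs
  have ht : 0 ≤ t := hs.1.trans hs.2
  -- Freezing `v` at its endpoint values outside `[0, t]` makes the primitive differentiable at
  -- every point, the endpoints included.
  set v' : ℝ → ℝ := fun r => v (projIcc 0 t ht r) with hv'
  have hc : Continuous v' :=
    (continuousOn_iff_continuous_domRestrict.1 hv).comp continuous_projIcc
  have hvv : ∀ r ∈ Icc 0 t, v' r = v r := fun r hr => by
    simp [hv', projIcc_of_mem ht hr]
  have hint : ∀ s ∈ Icc 0 t, ∫ r in (0 : ℝ)..s, v r = ∫ r in (0 : ℝ)..s, v' r := fun s hs =>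
    intervalIntegral.integral_congr fun r hr => by
      rw [uIcc_of_le hs.1] at hr
      exact (hvv r ⟨hr.1, hr.2.trans hs.2⟩).symm
  set z : ℝ → ℝ := fun s => δ + L * ∫ r in (0 : ℝ)..s, v' r with hz
  have hd : ∀ s, HasDerivAt z (L * v' s) s := fun s =>
    ((hc.integral_hasStrictDerivAt 0 s).hasDerivAt.const_mul L).const_add δ
  have hvz : ∀ s ∈ Icc 0 t, v' s ≤ z s := fun s hs => by
    have := h s hs
    rw [hint s hs] at this
    rw [hvv s hs]
    exact this
  have key := le_gronwallBound_of_liminf_deriv_right_le (f := z) (f' := fun s => L * v' s)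
    (δ := δ) (K := L) (ε := 0) (a := 0) (b := t)
    (fun s _ => (hd s).continuousAt.continuousWithinAt)
    (fun s _ r hr => ((hd s).hasDerivWithinAt (s := Ici s)).liminf_right_slope_le hr)
    (by simp [hz])
    (fun s hs => by
      have := mul_le_mul_of_nonneg_left (hvz s (Ico_subset_Icc_self hs)) hL
      simpa using this) s hs
  rw [sub_zero, gronwallBound_ε0] at key
  rw [← hvv s hs]
  exact (hvz s hs).trans key

/-! ### Elementary properties of the right-hand side -/

theorem JointlyLipschitzOnBoundedSets.continuous {f : StateSpace n → InputValue m → StateSpace n}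
    (hf : JointlyLipschitzOnBoundedSets f) : Continuous (Function.uncurry f) := by
  rw [continuous_iff_continuousAt]
  rintro ⟨x, v⟩
  obtain ⟨L, hL, h⟩ := hf (‖x‖ + ‖v‖ + 1) (by positivity)
  rw [ContinuousAt, tendsto_iff_norm_sub_tendsto_zero]
  have hlim : Tendsto (fun p : StateSpace n × InputValue m => L * (‖p.1 - x‖ + ‖p.2 - v‖))
      (𝓝 (x, v)) (𝓝 0) := by
    have : Continuous (fun p : StateSpace n × InputValue m => L * (‖p.1 - x‖ + ‖p.2 - v‖)) := by
      fun_prop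
    simpa using this.tendsto (x, v)
  refine squeeze_zero' (Eventually.of_forall fun _ => norm_nonneg _) ?_ hlim
  have h1 : ∀ᶠ p : StateSpace n × InputValue m in 𝓝 (x, v), ‖p.1‖ < ‖x‖ + ‖v‖ + 1 :=
    (continuous_fst.norm.tendsto (x, v)).eventually_lt_const
      (by have := norm_nonneg v; simp only; linarith)
  have h2 : ∀ᶠ p : StateSpace n × InputValue m in 𝓝 (x, v), ‖p.2‖ < ‖x‖ + ‖v‖ + 1 :=
    (continuous_snd.norm.tendsto (x, v)).eventually_lt_const
      (by have := norm_nonneg x; simp only; linarith)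
  filter_upwards [h1, h2] with p hp1 hp2
  exact h p.1 x p.2 v hp1 (by linarith [norm_nonneg v]) hp2 (by linarith [norm_nonneg x])

theorem exists_bound_of_continuous {f : StateSpace n → InputValue m → StateSpace n}
    (hf : Continuous (Function.uncurry f)) (B c : ℝ) :
    ∃ M : ℝ, 0 ≤ M ∧ ∀ x v, ‖x‖ ≤ B → ‖v‖ ≤ c → ‖f x v‖ ≤ M := by
  have hK : IsCompact (Metric.closedBall (0 : StateSpace n) B ×ˢ
      Metric.closedBall (0 : InputValue m) c) :=
    (isCompact_closedBall _ _).prod (isCompact_closedBall _ _)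
  obtain ⟨M, hM⟩ := hK.exists_bound_of_continuousOn hf.continuousOn
  refine ⟨max M 0, le_max_right _ _, fun x v hx hv => ?_⟩
  exact (hM (x, v) ⟨by simpa using hx, by simpa using hv⟩).trans (le_max_left _ _)

theorem JointlyLipschitzOnBoundedSets.lipschitz_state
    {f : StateSpace n → InputValue m → StateSpace n}
    (hf : JointlyLipschitzOnBoundedSets f) (B c : ℝ) :
    ∃ L : ℝ, 0 < L ∧ ∀ x y v, ‖x‖ ≤ B → ‖y‖ ≤ B → ‖v‖ ≤ c →
      ‖f x v - f y v‖ ≤ L * ‖x - y‖ := by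
  obtain ⟨L, hL, h⟩ := hf (|B| + |c| + 1) (by positivity)
  refine ⟨L, hL, fun x y v hx hy hv => ?_⟩
  have hB := le_abs_self B
  have hc := le_abs_self c
  have := h x y v v (by linarith [abs_nonneg c]) (by linarith [abs_nonneg c])
    (by linarith [abs_nonneg B]) (by linarith [abs_nonneg B])
  simpa using this

theorem integrableOn_rhs {f : StateSpace n → InputValue m → StateSpace n}
    (hf : Continuous (Function.uncurry f)) (u : Input m) {t : ℝ} {ξ : ℝ → StateSpace n}
    (hξ : ContinuousOn ξ (Icc 0 t)) : IntegrableOn (fun r => f (ξ r) (u r)) (Icc 0 t) := by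
  obtain ⟨B, hB⟩ := isCompact_Icc.exists_bound_of_continuousOn hξ
  obtain ⟨M, _, hM⟩ := exists_bound_of_continuous hf B ‖u‖
  have hmeas : AEStronglyMeasurable (fun r => f (ξ r) (u r)) (volume.restrict (Icc 0 t)) :=
    hf.comp_aestronglyMeasurable ((hξ.aestronglyMeasurable measurableSet_Icc).prodMk
      (Lp.stronglyMeasurable u).aestronglyMeasurable)
  refine Integrable.of_bound hmeas M ?_
  filter_upwards [ae_restrict_Icc_of_ae_restrict_Ici (ae_norm_le_norm_input u) le_rfl t,
    ae_restrict_mem measurableSet_Icc] with r hr hmem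
  exact hM _ _ (hB r hmem) hr

theorem intervalIntegrable_rhs {f : StateSpace n → InputValue m → StateSpace n}
    (hf : Continuous (Function.uncurry f)) (u : Input m) {t : ℝ} {ξ : ℝ → StateSpace n}
    (hξ : ContinuousOn ξ (Icc 0 t)) {a b : ℝ} (ha : a ∈ Icc 0 t) (hb : b ∈ Icc 0 t) :
    IntervalIntegrable (fun r => f (ξ r) (u r)) volume a b := by
  rw [intervalIntegrable_iff]
  refine (integrableOn_rhs hf u hξ).mono_set fun r hr => ?_
  have := uIoc_subset_uIcc hr
  exact (uIcc_subset_Icc ha hb) this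

/-! ### Solutions: restriction, uniqueness, concatenation, shift -/

theorem isSolutionUpTo_mk {f : StateSpace n → InputValue m → StateSpace n}
    (hf : Continuous (Function.uncurry f)) {x : StateSpace n} {u : Input m} {t : ℝ}
    {ξ : ℝ → StateSpace n} (ht : 0 ≤ t) (hξ : ContinuousOn ξ (Icc 0 t))
    (h : ∀ s ∈ Icc 0 t, ξ s = x + ∫ r in (0 : ℝ)..s, f (ξ r) (u r)) :
    IsSolutionUpTo f x u t ξ :=
  ⟨hξ, intervalIntegrable_rhs hf u hξ ⟨le_rfl, ht⟩ ⟨ht, le_rfl⟩, h⟩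

theorem IsSolutionUpTo.apply_zero {f : StateSpace n → InputValue m → StateSpace n}
    {x : StateSpace n} {u : Input m} {t : ℝ} {ξ : ℝ → StateSpace n}
    (h : IsSolutionUpTo f x u t ξ) (ht : 0 ≤ t) : ξ 0 = x := by
  simpa using h.integral_eq 0 ⟨le_rfl, ht⟩

theorem IsSolutionUpTo.mono {f : StateSpace n → InputValue m → StateSpace n}
    (hf : Continuous (Function.uncurry f)) {x : StateSpace n} {u : Input m} {t s : ℝ}
    {ξ : ℝ → StateSpace n} (h : IsSolutionUpTo f x u t ξ) (hs : s ∈ Icc 0 t) :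
    IsSolutionUpTo f x u s ξ :=
  isSolutionUpTo_mk hf hs.1 (h.continuousOn.mono (Icc_subset_Icc_right hs.2))
    fun r hr => h.integral_eq r ⟨hr.1, hr.2.trans hs.2⟩

theorem integral_rhs_congr {f g : StateSpace n → InputValue m → StateSpace n}
    {u v : ℝ → InputValue m} {t : ℝ} {ξ ζ : ℝ → StateSpace n}
    (h : ∀ᵐ r ∂(volume.restrict (Icc 0 t)), f (ξ r) (u r) = g (ζ r) (v r)) {s : ℝ}
    (hs : s ∈ Icc 0 t) :
    ∫ r in (0 : ℝ)..s, f (ξ r) (u r) = ∫ r in (0 : ℝ)..s, g (ζ r) (v r) := by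
  rw [ae_restrict_iff' measurableSet_Icc] at h
  refine intervalIntegral.integral_congr_ae ?_
  filter_upwards [h] with r hr hmem
  rw [uIoc_of_le hs.1] at hmem
  exact hr ⟨hmem.1.le, hmem.2.trans hs.2⟩

/-- Replacing the right-hand side and the input by ones that agree along the solution. -/
theorem IsSolutionUpTo.congr {f g : StateSpace n → InputValue m → StateSpace n}
    (hg : Continuous (Function.uncurry g)) {x : StateSpace n} {u v : Input m} {t : ℝ}
    {ξ : ℝ → StateSpace n} (ht : 0 ≤ t) (h : IsSolutionUpTo f x u t ξ)
    (he : ∀ᵐ r ∂(volume.restrict (Icc 0 t)), f (ξ r) (u r) = g (ξ r) (v r)) :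
    IsSolutionUpTo g x v t ξ :=
  isSolutionUpTo_mk hg ht h.continuousOn fun s hs => by
    rw [h.integral_eq s hs, integral_rhs_congr he hs]

theorem IsSolutionUpTo.congr_fun {f : StateSpace n → InputValue m → StateSpace n}
    (hf : Continuous (Function.uncurry f)) {x : StateSpace n} {u : Input m} {t : ℝ}
    {ξ ζ : ℝ → StateSpace n} (ht : 0 ≤ t) (h : IsSolutionUpTo f x u t ξ)
    (he : ∀ r ∈ Icc 0 t, ζ r = ξ r) : IsSolutionUpTo f x u t ζ :=
  isSolutionUpTo_mk hf ht (h.continuousOn.congr he) fun s hs => by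
    rw [he s hs, h.integral_eq s hs]
    congr 1
    refine (integral_rhs_congr ?_ hs).symm
    filter_upwards [ae_restrict_mem measurableSet_Icc] with r hr
    rw [he r hr]

/-- Grönwall's inequality for the difference of the integral equations. The Lipschitz bound is
required only along the two paths, so the lemma serves both locally Lipschitz and cut-off right-hand
sides. -/
theorem IsSolutionUpTo.norm_sub_le {f : StateSpace n → InputValue m → StateSpace n}
    (hf : Continuous (Function.uncurry f)) {x y : StateSpace n} {u : Input m} {t L : ℝ}
    {ξ ζ : ℝ → StateSpace n} (hL : 0 ≤ L)
    (hξ : IsSolutionUpTo f x u t ξ) (hζ : IsSolutionUpTo f y u t ζ)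
    (hLip : ∀ r ∈ Icc 0 t, ∀ v, ‖v‖ ≤ ‖u‖ → ‖f (ξ r) v - f (ζ r) v‖ ≤ L * ‖ξ r - ζ r‖) :
    ∀ s ∈ Icc 0 t, ‖ξ s - ζ s‖ ≤ ‖x - y‖ * Real.exp (L * s) := by
  refine le_mul_exp_of_le_add_integral hL (hξ.continuousOn.sub hζ.continuousOn).norm ?_
  intro s hs
  have h0 : (0 : ℝ) ∈ Icc 0 t := ⟨le_rfl, hs.1.trans hs.2⟩
  have e1 := intervalIntegrable_rhs hf u hξ.continuousOn h0 hs
  have e2 := intervalIntegrable_rhs hf u hζ.continuousOn h0 hs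
  have hcn : ContinuousOn (fun r => L * ‖ξ r - ζ r‖) (Icc 0 t) :=
    continuousOn_const.mul (hξ.continuousOn.sub hζ.continuousOn).norm
  have e3 : IntervalIntegrable (fun r => L * ‖ξ r - ζ r‖) volume 0 s := by
    refine ContinuousOn.intervalIntegrable (hcn.mono ?_)
    rw [uIcc_of_le hs.1]
    exact Icc_subset_Icc_right hs.2
  have hsub : ξ s - ζ s = (x - y) + ∫ r in (0 : ℝ)..s, (f (ξ r) (u r) - f (ζ r) (u r)) := by
    rw [intervalIntegral.integral_sub e1 e2, hξ.integral_eq s hs, hζ.integral_eq s hs]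
    abel
  have hle : ‖∫ r in (0 : ℝ)..s, (f (ξ r) (u r) - f (ζ r) (u r))‖
      ≤ ∫ r in (0 : ℝ)..s, L * ‖ξ r - ζ r‖ := by
    refine intervalIntegral.norm_integral_le_of_norm_le hs.1 ?_ e3
    have hb := ae_restrict_Icc_of_ae_restrict_Ici (ae_norm_le_norm_input u) le_rfl t
    rw [ae_restrict_iff' measurableSet_Icc] at hb
    filter_upwards [hb] with r hr hmem
    have hm : r ∈ Icc 0 t := ⟨hmem.1.le, hmem.2.trans hs.2⟩
    exact hLip r hm _ (hr hm)
  rw [intervalIntegral.integral_const_mul] at hle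
  rw [hsub]
  exact (norm_add_le _ _).trans (by linarith)

theorem IsSolutionUpTo.eqOn {f : StateSpace n → InputValue m → StateSpace n}
    (hf : JointlyLipschitzOnBoundedSets f) {x : StateSpace n} {u : Input m} {t : ℝ}
    {ξ ζ : ℝ → StateSpace n}
    (hξ : IsSolutionUpTo f x u t ξ) (hζ : IsSolutionUpTo f x u t ζ) :
    EqOn ξ ζ (Icc 0 t) := by
  intro s hs
  obtain ⟨B₁, hB₁⟩ := isCompact_Icc.exists_bound_of_continuousOn hξ.continuousOn
  obtain ⟨B₂, hB₂⟩ := isCompact_Icc.exists_bound_of_continuousOn hζ.continuousOn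
  obtain ⟨L, hL, h⟩ := hf.lipschitz_state (max B₁ B₂) ‖u‖
  have := hξ.norm_sub_le hf.continuous hL.le hζ (fun r hr v hv =>
    h _ _ v ((hB₁ r hr).trans (le_max_left _ _)) ((hB₂ r hr).trans (le_max_right _ _)) hv) s hs
  rw [sub_self, norm_zero, zero_mul] at this
  exact sub_eq_zero.1 (norm_le_zero_iff.1 this)

theorem IsSolutionUpTo.flow_eq {f : StateSpace n → InputValue m → StateSpace n}
    (hf : JointlyLipschitzOnBoundedSets f) {x : StateSpace n} {u : Input m} {t : ℝ}
    {ξ : ℝ → StateSpace n} (hξ : IsSolutionUpTo f x u t ξ) {s : ℝ} (hs : s ∈ Icc 0 t) :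
    flow f s x u = ξ s := by
  have h : ∃ ζ : ℝ → StateSpace n, IsSolutionUpTo f x u s ζ := ⟨ξ, hξ.mono hf.continuous hs⟩
  rw [flow, dif_pos h]
  exact h.choose_spec.eqOn hf (hξ.mono hf.continuous hs) ⟨hs.1, le_rfl⟩

theorem ForwardComplete.isSolutionUpTo {f : StateSpace n → InputValue m → StateSpace n}
    (hf : JointlyLipschitzOnBoundedSets f) (hc : ForwardComplete f) (x : StateSpace n)
    (u : Input m) {t : ℝ} (ht : 0 ≤ t) : IsSolutionUpTo f x u t (fun s => flow f s x u) := by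
  obtain ⟨_, ξ, hξ⟩ := hc x u t ht
  exact hξ.congr_fun hf.continuous ht fun r hr => hξ.flow_eq hf hr

/-- The integral equation of a solution, started at an intermediate time. -/
theorem IsSolutionUpTo.eq_add_integral {f : StateSpace n → InputValue m → StateSpace n}
    (hf : Continuous (Function.uncurry f)) {x : StateSpace n} {u : Input m} {t : ℝ}
    {ξ : ℝ → StateSpace n} (hξ : IsSolutionUpTo f x u t ξ) {a b : ℝ} (ha : a ∈ Icc 0 t)
    (hb : b ∈ Icc 0 t) : ξ b = ξ a + ∫ r in a..b, f (ξ r) (u r) := by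
  have h0 : (0 : ℝ) ∈ Icc 0 t := ⟨le_rfl, ha.1.trans ha.2⟩
  rw [hξ.integral_eq a ha, hξ.integral_eq b hb, add_assoc,
    intervalIntegral.integral_add_adjacent_intervals
      (intervalIntegrable_rhs hf u hξ.continuousOn h0 ha)
      (intervalIntegrable_rhs hf u hξ.continuousOn ha hb)]

theorem ae_add_left_of_ae_restrict_Ici {p : ℝ → Prop}
    (h : ∀ᵐ r ∂(volume.restrict (Ici (0 : ℝ))), p r) {s : ℝ} (hs : 0 ≤ s) :
    ∀ᵐ r ∂(volume.restrict (Ici (0 : ℝ))), p (s + r) := by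
  rw [ae_restrict_iff' measurableSet_Ici] at h ⊢
  have := (measurePreserving_add_left (volume : Measure ℝ) s).quasiMeasurePreserving.ae h
  filter_upwards [this] with r hr hr0
  exact hr (add_nonneg hs hr0)

/-- The shifted input `u(s + ·)`. -/
theorem exists_shift (u : Input m) {s : ℝ} (hs : 0 ≤ s) :
    ∃ v : Input m, (∀ᵐ r ∂(volume.restrict (Ici (0 : ℝ))), v r = u (s + r)) ∧ ‖v‖ ≤ ‖u‖ :=
  exists_input (norm_nonneg u)
    ((Lp.stronglyMeasurable u).comp_measurable (measurable_const_add s)).aestronglyMeasurable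
    (ae_add_left_of_ae_restrict_Ici (ae_norm_le_norm_input u) hs)

theorem IsSolutionUpTo.shift {f : StateSpace n → InputValue m → StateSpace n}
    (hf : Continuous (Function.uncurry f)) {x : StateSpace n} {u v : Input m} {s t : ℝ}
    {ξ : ℝ → StateSpace n} (hξ : IsSolutionUpTo f x u (s + t) ξ) (hs : 0 ≤ s) (ht : 0 ≤ t)
    (hv : ∀ᵐ r ∂(volume.restrict (Icc 0 t)), v r = u (s + r)) :
    IsSolutionUpTo f (ξ s) v t (fun r => ξ (s + r)) := by
  have hmaps : MapsTo (fun r => s + r) (Icc 0 t) (Icc 0 (s + t)) := fun r hr =>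
    ⟨add_nonneg hs hr.1, by linarith [hr.2]⟩
  refine isSolutionUpTo_mk hf ht (hξ.continuousOn.comp (by fun_prop) hmaps) fun r hr => ?_
  rw [hξ.eq_add_integral hf (a := s) (b := s + r) ⟨hs, by linarith⟩ (hmaps hr)]
  congr 1
  have h2 : ∫ q in (0 : ℝ)..r, f (ξ (s + q)) (v q)
      = ∫ q in (0 : ℝ)..r, f (ξ (s + q)) (u (s + q)) :=
    integral_rhs_congr (u := v) (v := fun q => u (s + q)) (ξ := fun q => ξ (s + q))
      (ζ := fun q => ξ (s + q)) (by filter_upwards [hv] with q hq; rw [hq]) hr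
  rw [h2, intervalIntegral.integral_comp_add_left (fun q => f (ξ q) (u q)) s, add_zero]

/-- The concatenation of `u` on `[0, s)` with `v` started at time `s`. -/
theorem exists_concat (u v : Input m) {s c : ℝ} (hu : ‖u‖ ≤ c) (hv : ‖v‖ ≤ c) :
    ∃ w : Input m, (∀ᵐ r ∂(volume.restrict (Ici (0 : ℝ))),
      w r = if r < s then u r else v (r - s)) ∧ ‖w‖ ≤ c := by
  classical
  refine exists_input ((norm_nonneg u).trans hu) ?_ ?_
  · refine StronglyMeasurable.aestronglyMeasurable ?_
    exact StronglyMeasurable.ite measurableSet_Iio (Lp.stronglyMeasurable u)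
      ((Lp.stronglyMeasurable v).comp_measurable (measurable_sub_const s))
  · have h1 := ae_norm_le_norm_input u
    have h2 := ae_norm_le_norm_input v
    rw [ae_restrict_iff' measurableSet_Ici] at h1 h2 ⊢
    have h3 := (measurePreserving_sub_right (volume : Measure ℝ) s).quasiMeasurePreserving.ae h2
    filter_upwards [h1, h3] with r hr1 hr3 hr
    split_ifs with hrs
    · exact (hr1 hr).trans hu
    · exact (hr3 (by simpa using hrs)).trans hv

theorem IsSolutionUpTo.concat {f : StateSpace n → InputValue m → StateSpace n}
    (hf : Continuous (Function.uncurry f)) {x : StateSpace n} {u v w : Input m} {s t : ℝ}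
    {ξ ζ : ℝ → StateSpace n} (hξ : IsSolutionUpTo f x u s ξ) (hs : 0 ≤ s) (ht : 0 ≤ t)
    (hζ : IsSolutionUpTo f (ξ s) v t ζ)
    (hw : ∀ᵐ r ∂(volume.restrict (Ici (0 : ℝ))), w r = if r < s then u r else v (r - s)) :
    IsSolutionUpTo f x w (s + t) (fun r => if r ≤ s then ξ r else ζ (r - s)) := by
  set η : ℝ → StateSpace n := fun r => if r ≤ s then ξ r else ζ (r - s) with hη
  have hζ0 : ζ 0 = ξ s := hζ.apply_zero ht
  have h1 : EqOn η ξ (Icc 0 s) := fun r hr => by simp [hη, hr.2]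
  have h2 : EqOn η (fun r => ζ (r - s)) (Icc s (s + t)) := fun r hr => by
    rcases hr.1.eq_or_lt with h | h
    · simp [hη, ← h, hζ0]
    · simp [hη, not_le.2 h]
  have hcont : ContinuousOn η (Icc 0 (s + t)) := by
    have hu : Icc 0 (s + t) = Icc 0 s ∪ Icc s (s + t) :=
      (Icc_union_Icc_eq_Icc hs (by linarith)).symm
    rw [hu]
    refine ContinuousOn.union_of_isClosed (hξ.continuousOn.congr h1) ?_ isClosed_Icc isClosed_Icc
    refine ContinuousOn.congr ?_ h2
    exact hζ.continuousOn.comp (by fun_prop) fun r hr => ⟨by linarith [hr.1], by linarith [hr.2]⟩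
  have hw' := hw
  rw [ae_restrict_iff' measurableSet_Ici] at hw'
  -- The path switches after time `s` but the input switches at `s` itself; the mismatch is one null
  -- point.
  have hwn : ∀ᵐ r : ℝ, r ≠ s := by simp [ae_iff]
  have hint1 : ∀ r ∈ Icc 0 s, ∫ q in (0 : ℝ)..r, f (η q) (w q)
      = ∫ q in (0 : ℝ)..r, f (ξ q) (u q) := fun r hr =>
    integral_rhs_congr (by
      rw [ae_restrict_iff' measurableSet_Icc]
      filter_upwards [hw', hwn] with q hq hqs hmem
      rw [h1 hmem, hq hmem.1, if_pos (lt_of_le_of_ne hmem.2 hqs)]) hr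
  have hfirst : ∀ r ∈ Icc 0 s, η r = x + ∫ q in (0 : ℝ)..r, f (η q) (w q) := fun r hr => by
    rw [hint1 r hr, h1 hr, hξ.integral_eq r hr]
  refine isSolutionUpTo_mk hf (add_nonneg hs ht) hcont fun r hr => ?_
  rcases le_total r s with hrs | hrs
  · exact hfirst r ⟨hr.1, hrs⟩
  · have hs' : s ∈ Icc 0 (s + t) := ⟨hs, by linarith⟩
    have h0 : (0 : ℝ) ∈ Icc 0 (s + t) := ⟨le_rfl, by linarith⟩
    rw [← intervalIntegral.integral_add_adjacent_intervals
      (intervalIntegrable_rhs hf w hcont h0 hs') (intervalIntegrable_rhs hf w hcont hs' hr),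
      ← add_assoc, ← hfirst s ⟨hs, le_rfl⟩, h1 ⟨hs, le_rfl⟩, h2 ⟨hrs, hr.2⟩]
    simp only
    rw [hζ.integral_eq (r - s) ⟨by linarith, by linarith [hr.2]⟩]
    congr 1
    have : ∫ q in s..r, f (η q) (w q) = ∫ q in s..r, f (ζ (q - s)) (v (q - s)) := by
      refine intervalIntegral.integral_congr_ae ?_
      filter_upwards [hw'] with q hq hmem
      rw [uIoc_of_le hrs] at hmem
      rw [h2 ⟨hmem.1.le, hmem.2.trans hr.2⟩, hq (hs.trans hmem.1.le), if_neg (not_lt.2 hmem.1.le)]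
    rw [this, intervalIntegral.integral_comp_sub_right (fun q => f (ζ q) (v q)) s, sub_self]

end Basics

/-! ### Global existence and continuous dependence -/

section Existence

variable {n m : ℕ}

/-- Picard iteration in the weighted supremum norm with weight `exp(-2 L t)`: the integral operator
is then a contraction with factor `1/2` on all of `[0, T]`, so no gluing of short intervals is
needed. -/
theorem exists_isSolutionUpTo_of_lipschitz {f : StateSpace n → InputValue m → StateSpace n}
    (hf : Continuous (Function.uncurry f)) (x : StateSpace n) (u : Input m) {T L : ℝ}
    (hT : 0 ≤ T) (hL : 0 < L)
    (hLip : ∀ a b v, ‖v‖ ≤ ‖u‖ → ‖f a v - f b v‖ ≤ L * ‖a - b‖) :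
    ∃ ξ : ℝ → StateSpace n, IsSolutionUpTo f x u T ξ := by
  set y : C(Icc (0 : ℝ) T, StateSpace n) → ℝ → StateSpace n :=
    fun η r => Real.exp (2 * L * r) • η (projIcc 0 T hT r) with hy
  have hyc : ∀ η, Continuous (y η) := fun η =>
    (by fun_prop : Continuous fun r : ℝ => Real.exp (2 * L * r)).smul
      (η.continuous.comp continuous_projIcc)
  have hint : ∀ η, ∀ t ∈ Icc 0 T, IntervalIntegrable (fun r => f (y η r) (u r)) volume 0 t :=
    fun η t ht => intervalIntegrable_rhs hf u (hyc η).continuousOn ⟨le_rfl, hT⟩ ht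
  have hprim : ∀ η, ContinuousOn (fun t => ∫ r in (0 : ℝ)..t, f (y η r) (u r)) (Icc 0 T) := by
    intro η
    have := intervalIntegral.continuousOn_primitive_interval
      (f := fun r => f (y η r) (u r)) (μ := volume) (a := 0) (b := T)
      (by rw [uIcc_of_le hT]; exact integrableOn_rhs hf u (hyc η).continuousOn)
    rwa [uIcc_of_le hT] at this
  set S : C(Icc (0 : ℝ) T, StateSpace n) → C(Icc (0 : ℝ) T, StateSpace n) := fun η =>
    ⟨fun t => Real.exp (-(2 * L * t)) • (x + ∫ r in (0 : ℝ)..t, f (y η r) (u r)),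
      (by fun_prop : Continuous fun t : Icc (0 : ℝ) T => Real.exp (-(2 * L * t))).smul
        (continuous_const.add (continuousOn_iff_continuous_domRestrict.1 (hprim η)))⟩ with hS
  have hcontr : ContractingWith (1 / 2) S := by
    refine ⟨by rw [← NNReal.coe_lt_coe]; norm_num, LipschitzWith.of_dist_le_mul fun η ζ => ?_⟩
    rw [ContinuousMap.dist_le (by positivity)]
    rintro ⟨t, ht⟩
    set D := dist η ζ with hD
    have hD0 : 0 ≤ D := dist_nonneg
    have hpt : ∀ r, ‖y η r - y ζ r‖ ≤ Real.exp (2 * L * r) * D := fun r => by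
      simp only [hy]
      rw [← smul_sub, norm_smul, Real.norm_of_nonneg (Real.exp_pos _).le, ← dist_eq_norm]
      exact mul_le_mul_of_nonneg_left (ContinuousMap.dist_apply_le_dist _) (Real.exp_pos _).le
    have hexp : ∫ r in (0 : ℝ)..t, L * (Real.exp (2 * L * r) * D)
        = D / 2 * Real.exp (2 * L * t) - D / 2 * Real.exp (2 * L * 0) := by
      refine intervalIntegral.integral_eq_sub_of_hasDerivAt
        (f := fun r => D / 2 * Real.exp (2 * L * r)) (fun r _ => ?_)
        (Continuous.intervalIntegrable (by fun_prop) _ _)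
      have h1 : HasDerivAt (fun r : ℝ => 2 * L * r) (2 * L) r := by
        simpa using (hasDerivAt_id r).const_mul (2 * L)
      exact (h1.exp.const_mul (D / 2)).congr_deriv (by ring)
    have hle : ‖∫ r in (0 : ℝ)..t, (f (y η r) (u r) - f (y ζ r) (u r))‖
        ≤ ∫ r in (0 : ℝ)..t, L * (Real.exp (2 * L * r) * D) := by
      refine intervalIntegral.norm_integral_le_of_norm_le ht.1 ?_
        (Continuous.intervalIntegrable (by fun_prop) _ _)
      have hb := ae_norm_le_norm_input u
      rw [ae_restrict_iff' measurableSet_Ici] at hb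
      filter_upwards [hb] with r hr hmem
      exact (hLip _ _ _ (hr hmem.1.le)).trans (mul_le_mul_of_nonneg_left (hpt r) hL.le)
    have hdist : dist (S η ⟨t, ht⟩) (S ζ ⟨t, ht⟩) = Real.exp (-(2 * L * t)) *
        ‖∫ r in (0 : ℝ)..t, (f (y η r) (u r) - f (y ζ r) (u r))‖ := by
      rw [intervalIntegral.integral_sub (hint η t ht) (hint ζ t ht), dist_eq_norm]
      simp only [hS, ContinuousMap.coe_mk]
      rw [← smul_sub, norm_smul, Real.norm_of_nonneg (Real.exp_pos _).le, add_sub_add_left_eq_sub]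
    rw [hdist]
    refine (mul_le_mul_of_nonneg_left (hle.trans_eq hexp) (Real.exp_pos _).le).trans ?_
    have he : Real.exp (-(2 * L * t)) * Real.exp (2 * L * t) = 1 := by
      rw [← Real.exp_add]; simp
    have h0 : 0 ≤ Real.exp (-(2 * L * t)) * (D / 2) := by positivity
    simp only [mul_zero, Real.exp_zero, mul_one]
    push_cast
    calc Real.exp (-(2 * L * t)) * (D / 2 * Real.exp (2 * L * t) - D / 2)
        = D / 2 * (Real.exp (-(2 * L * t)) * Real.exp (2 * L * t))
          - Real.exp (-(2 * L * t)) * (D / 2) := by ring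
      _ ≤ 1 / 2 * D := by rw [he]; linarith
  have : Nonempty C(Icc (0 : ℝ) T, StateSpace n) := ⟨0⟩
  set η := ContractingWith.fixedPoint S hcontr
  have hfix : S η = η := hcontr.fixedPoint_isFixedPt
  refine ⟨y η, isSolutionUpTo_mk hf hT (hyc η).continuousOn fun s hs => ?_⟩
  have h1 : η ⟨s, hs⟩ = Real.exp (-(2 * L * s)) • (x + ∫ r in (0 : ℝ)..s, f (y η r) (u r)) := by
    conv_lhs => rw [← hfix]
    rfl
  have h2 : y η s = Real.exp (2 * L * s) • η ⟨s, hs⟩ := by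
    simp only [hy, projIcc_of_mem hT hs]
  rw [h2, h1, smul_smul, ← Real.exp_add]
  simp

/-! ### Cut-off of the right-hand side and a priori bounds. -/

theorem norm_radial_retraction_sub_le {E : Type*} [NormedAddCommGroup E] [NormedSpace ℝ E]
    {c : ℝ} (hc : 0 < c) (x y : E) :
    ‖(c / max c ‖x‖) • x - (c / max c ‖y‖) • y‖ ≤ 2 * ‖x - y‖ := by
  have hx : 0 < max c ‖x‖ := hc.trans_le (le_max_left _ _)
  have hy : 0 < max c ‖y‖ := hc.trans_le (le_max_left _ _)
  -- One term for the change of the vector and one for the change of the scaling factor; each is at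
  -- most `‖x - y‖`, whence the constant 2.
  have e : (c / max c ‖x‖) • x - (c / max c ‖y‖) • y
      = (c / max c ‖x‖) • (x - y) + (c / max c ‖x‖ - c / max c ‖y‖) • y := by
    rw [smul_sub, sub_smul]; abel
  have h1 : c / max c ‖x‖ ≤ 1 := (div_le_one hx).2 (le_max_left _ _)
  have h2 : |max c ‖y‖ - max c ‖x‖| ≤ ‖x - y‖ := by
    have := abs_max_sub_max_le_abs ‖y‖ ‖x‖ c
    rw [max_comm c, max_comm c]
    refine this.trans ?_
    rw [norm_sub_rev]
    exact abs_norm_sub_norm_le y x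
  have h3 : ‖(c / max c ‖x‖ - c / max c ‖y‖) • y‖ ≤ ‖x - y‖ := by
    have e3 : c / max c ‖x‖ - c / max c ‖y‖
        = (c / max c ‖x‖) * ((max c ‖y‖ - max c ‖x‖) / max c ‖y‖) := by
      field_simp
    rw [norm_smul, e3, Real.norm_eq_abs, abs_mul, abs_div (_ - _), abs_of_pos hy,
      abs_of_pos (div_pos hc hx), mul_assoc]
    have h4 : |max c ‖y‖ - max c ‖x‖| / max c ‖y‖ * ‖y‖ ≤ ‖x - y‖ := by
      rw [div_mul_eq_mul_div, div_le_iff₀ hy]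
      exact mul_le_mul h2 (le_max_right _ _) (norm_nonneg _) (norm_nonneg _)
    calc _ ≤ 1 * ‖x - y‖ := mul_le_mul h1 h4 (by positivity) zero_le_one
      _ = _ := one_mul _
  have h5 : ‖(c / max c ‖x‖) • (x - y)‖ ≤ ‖x - y‖ := by
    rw [norm_smul, Real.norm_of_nonneg (div_pos hc hx).le]
    exact mul_le_of_le_one_left (norm_nonneg _) h1
  rw [e]
  exact (norm_add_le _ _).trans (by linarith)

/-- Precomposing the state variable with the radial retraction onto a ball makes the local Lipschitz
constant global without changing the values inside the ball. -/
theorem JointlyLipschitzOnBoundedSets.exists_cutoff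
    {f : StateSpace n → InputValue m → StateSpace n}
    (hf : JointlyLipschitzOnBoundedSets f) (B c : ℝ) :
    ∃ g : StateSpace n → InputValue m → StateSpace n, Continuous (Function.uncurry g) ∧
      (∀ x v, ‖x‖ ≤ B → g x v = f x v) ∧
      ∃ L : ℝ, 0 < L ∧ ∀ x y v, ‖v‖ ≤ c → ‖g x v - g y v‖ ≤ L * ‖x - y‖ := by
  set R := max B 1 with hR
  have hR0 : 0 < R := zero_lt_one.trans_le (le_max_right _ _)
  have hmax : ∀ x : StateSpace n, 0 < max R ‖x‖ := fun x => hR0.trans_le (le_max_left _ _)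
  set P : StateSpace n → StateSpace n := fun x => (R / max R ‖x‖) • x with hP
  have hPn : ∀ x, ‖P x‖ ≤ R := fun x => by
    rw [hP, norm_smul, Real.norm_of_nonneg (div_pos hR0 (hmax x)).le, div_mul_eq_mul_div,
      div_le_iff₀ (hmax x)]
    exact mul_le_mul_of_nonneg_left (le_max_right _ _) hR0.le
  have hPc : Continuous P :=
    (continuous_const.div (continuous_const.max continuous_norm) fun x => (hmax x).ne').smul
      continuous_id
  obtain ⟨L, hL, h⟩ := hf.lipschitz_state R c
  refine ⟨fun x v => f (P x) v, hf.continuous.comp (hPc.prodMap continuous_id), ?_, 2 * L,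
    by positivity, fun x y v hv => ?_⟩
  · intro x v hx
    have : P x = x := by
      rw [hP]
      simp only
      rw [max_eq_left (hx.trans (le_max_left _ _)), div_self hR0.ne', one_smul]
    simp only [this]
  · refine (h _ _ v (hPn x) (hPn y) hv).trans ?_
    have := mul_le_mul_of_nonneg_left (norm_radial_retraction_sub_le hR0 x y) hL.le
    linarith

/-- A continuous path starting in the open ball of radius `R` either stays in it or hits the
sphere at a first time. -/
theorem exists_first_hit {E : Type*} [SeminormedAddCommGroup E] {ξ : ℝ → E} {t R : ℝ}
    (hξ : ContinuousOn ξ (Icc 0 t)) (h0 : ‖ξ 0‖ ≤ R) {s : ℝ} (hs : s ∈ Icc 0 t)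
    (hR : R ≤ ‖ξ s‖) :
    ∃ σ ∈ Icc 0 s, ‖ξ σ‖ = R ∧ ∀ r ∈ Icc 0 σ, ‖ξ r‖ ≤ R := by
  have hsub : Icc 0 s ⊆ Icc 0 t := Icc_subset_Icc_right hs.2
  have hn : ContinuousOn (fun r => ‖ξ r‖) (Icc 0 s) := (hξ.mono hsub).norm
  set A := Icc 0 s ∩ (fun r => ‖ξ r‖) ⁻¹' Ici R with hA
  have hAc : IsCompact A :=
    isCompact_Icc.of_isClosed_subset (hn.preimage_isClosed_of_isClosed isClosed_Icc isClosed_Ici)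
      inter_subset_left
  have hAne : A.Nonempty := ⟨s, ⟨hs.1, le_rfl⟩, hR⟩
  obtain ⟨σ, hσA, hσ⟩ := hAc.exists_isLeast hAne
  have hle : ∀ r ∈ Icc 0 σ, r ≠ σ → ‖ξ r‖ ≤ R := fun r hr hne => by
    by_contra! hlt
    exact hne (le_antisymm hr.2 (hσ ⟨⟨hr.1, hr.2.trans hσA.1.2⟩, hlt.le⟩))
  have hσR : ‖ξ σ‖ ≤ R := by
    rcases hσA.1.1.eq_or_lt with h | h
    · rw [← h]; exact h0
    · have hcl : σ ∈ closure (Ioo 0 σ) := by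
        rw [closure_Ioo h.ne]; exact ⟨h.le, le_rfl⟩
      have hcw : ContinuousWithinAt (fun r => ‖ξ r‖) (Ioo 0 σ) σ :=
        (hn σ hσA.1).mono fun r hr => ⟨hr.1.le, hr.2.le.trans hσA.1.2⟩
      have := hcw.mem_closure hcl (t := Iic R) fun r hr => hle r ⟨hr.1.le, hr.2.le⟩ hr.2.ne
      simpa using this
  refine ⟨σ, hσA.1, le_antisymm hσR hσA.2, fun r hr => ?_⟩
  by_cases h : r = σ
  · rw [h]; exact hσR
  · exact hle r hr h

/-- A solution exists as long as solutions obey an a priori bound. -/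
theorem exists_isSolutionUpTo_of_bound {f : StateSpace n → InputValue m → StateSpace n}
    (hf : JointlyLipschitzOnBoundedSets f) (x : StateSpace n) (u : Input m) {T B : ℝ}
    (hT : 0 ≤ T) (hB : ∀ t ∈ Icc 0 T, ∀ ξ, IsSolutionUpTo f x u t ξ → ‖ξ t‖ ≤ B) :
    ∃ ξ : ℝ → StateSpace n, IsSolutionUpTo f x u T ξ := by
  -- Up to its first hit of the sphere of radius `max B ‖x‖ + 1` a solution for `g` also solves the
  -- original equation, so `hB` rules out such a hit.
  obtain ⟨g, hg, hgf, L, hL, hLip⟩ := hf.exists_cutoff (max B ‖x‖ + 1) ‖u‖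
  obtain ⟨ξ, hξ⟩ := exists_isSolutionUpTo_of_lipschitz hg x u hT hL hLip
  have key : ∀ s ∈ Icc 0 T, (∀ r ∈ Icc 0 s, ‖ξ r‖ ≤ max B ‖x‖ + 1) →
      IsSolutionUpTo f x u s ξ := fun s hs h =>
    (hξ.mono hg hs).congr hf.continuous hs.1 (by
      filter_upwards [ae_restrict_mem measurableSet_Icc] with r hr
      exact hgf _ _ (h r hr))
  refine ⟨ξ, key T ⟨hT, le_rfl⟩ fun r hr => ?_⟩
  by_contra! hlt
  obtain ⟨σ, hσ, hσR, hσle⟩ := exists_first_hit hξ.continuousOn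
    (by rw [hξ.apply_zero hT]; linarith [le_max_right B ‖x‖]) hr hlt.le
  have hσT : σ ∈ Icc 0 T := ⟨hσ.1, hσ.2.trans hr.2⟩
  have := hB σ hσT ξ (key σ hσT hσle)
  linarith [le_max_left B ‖x‖]

/-- Solutions starting near a bounded solution exist as long as the latter and stay close. -/
theorem JointlyLipschitzOnBoundedSets.exists_nearby
    {f : StateSpace n → InputValue m → StateSpace n}
    (hf : JointlyLipschitzOnBoundedSets f) (B c : ℝ) :
    ∃ L : ℝ, 0 < L ∧ ∀ (u : Input m) (x y : StateSpace n) (T : ℝ) (ξ : ℝ → StateSpace n),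
      ‖u‖ ≤ c → 0 ≤ T → IsSolutionUpTo f x u T ξ → (∀ r ∈ Icc 0 T, ‖ξ r‖ ≤ B) →
      ‖x - y‖ * Real.exp (L * T) ≤ 1 →
      ∃ ζ, IsSolutionUpTo f y u T ζ ∧
        ∀ s ∈ Icc 0 T, ‖ξ s - ζ s‖ ≤ ‖x - y‖ * Real.exp (L * T) := by
  obtain ⟨g, hg, hgf, L, hL, hLip⟩ := hf.exists_cutoff (B + 1) c
  refine ⟨L, hL, fun u x y T ξ hu hT hξ hξB hsmall => ?_⟩
  have hLip' : ∀ a b v, ‖v‖ ≤ ‖u‖ → ‖g a v - g b v‖ ≤ L * ‖a - b‖ :=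
    fun a b v hv => hLip a b v (hv.trans hu)
  obtain ⟨ζ, hζ⟩ := exists_isSolutionUpTo_of_lipschitz hg y u hT hL hLip'
  have hξg : IsSolutionUpTo g x u T ξ := hξ.congr hg hT (by
    filter_upwards [ae_restrict_mem measurableSet_Icc] with r hr
    exact (hgf _ _ ((hξB r hr).trans (by linarith))).symm)
  have hd : ∀ s ∈ Icc 0 T, ‖ξ s - ζ s‖ ≤ ‖x - y‖ * Real.exp (L * T) := fun s hs => by
    refine (hξg.norm_sub_le hg hL.le hζ (fun r _ v hv => hLip' _ _ v hv) s hs).trans ?_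
    exact mul_le_mul_of_nonneg_left
      (Real.exp_le_exp.2 (mul_le_mul_of_nonneg_left hs.2 hL.le)) (norm_nonneg _)
  refine ⟨ζ, hζ.congr hf.continuous hT ?_, hd⟩
  filter_upwards [ae_restrict_mem measurableSet_Icc] with r hr
  refine hgf _ _ ?_
  have h1 := (hd r hr).trans hsmall
  have h2 := hξB r hr
  have h3 := norm_sub_norm_le (ζ r) (ξ r)
  rw [norm_sub_rev] at h3
  linarith

/-! ### Time reversal. -/

theorem exists_reverse (u : Input m) {T : ℝ} :
    ∃ v : Input m, (∀ᵐ r ∂(volume.restrict (Icc (0 : ℝ) T)), v r = u (T - r)) ∧ ‖v‖ ≤ ‖u‖ := by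
  classical
  have h1 := ae_norm_le_norm_input u
  rw [ae_restrict_iff' measurableSet_Ici] at h1
  have h2 := (Measure.measurePreserving_sub_left (volume : Measure ℝ) T).quasiMeasurePreserving.ae h1
  obtain ⟨v, hv, hvn⟩ := exists_input (w := fun r => if r ≤ T then u (T - r) else 0)
    (norm_nonneg u) (StronglyMeasurable.ite measurableSet_Iic
      ((Lp.stronglyMeasurable u).comp_measurable (measurable_const_sub T))
      stronglyMeasurable_const).aestronglyMeasurable (by
        refine ae_restrict_of_ae ?_
        filter_upwards [h2] with r hr
        split_ifs with hrT
        · exact hr (by simpa using hrT)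
        · simp)
  refine ⟨v, ?_, hvn⟩
  filter_upwards [ae_restrict_Icc_of_ae_restrict_Ici hv le_rfl T,
    ae_restrict_mem measurableSet_Icc] with r hr hmem
  rw [hr, if_pos hmem.2]

theorem IsSolutionUpTo.reverse {f : StateSpace n → InputValue m → StateSpace n}
    (hf : Continuous (Function.uncurry f)) {x : StateSpace n} {u v : Input m} {T : ℝ}
    {ξ : ℝ → StateSpace n} (hξ : IsSolutionUpTo f x u T ξ) (hT : 0 ≤ T)
    (hv : ∀ᵐ r ∂(volume.restrict (Icc (0 : ℝ) T)), v r = u (T - r)) :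
    IsSolutionUpTo (fun x w => -f x w) (ξ T) v T (fun r => ξ (T - r)) := by
  have hmaps : MapsTo (fun r => T - r) (Icc 0 T) (Icc 0 T) := fun r hr =>
    ⟨by linarith [hr.2], by linarith [hr.1]⟩
  refine isSolutionUpTo_mk hf.neg hT (hξ.continuousOn.comp (by fun_prop) hmaps) fun s hs => ?_
  have h1 := hξ.eq_add_integral hf (hmaps hs) (b := T) ⟨hT, le_rfl⟩
  have h2 : ∫ r in (0 : ℝ)..s, -f (ξ (T - r)) (v r)
      = ∫ r in (0 : ℝ)..s, -f (ξ (T - r)) (u (T - r)) :=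
    integral_rhs_congr (f := fun x w => -f x w) (g := fun x w => -f x w)
      (u := v) (v := fun q => u (T - q)) (ξ := fun q => ξ (T - q))
      (ζ := fun q => ξ (T - q)) (by filter_upwards [hv] with q hq; rw [hq]) hs
  rw [h2, intervalIntegral.integral_neg,
    intervalIntegral.integral_comp_sub_left (fun q => f (ξ q) (u q)) T, sub_zero]
  rw [h1]
  simp

/-- Points near the endpoint of a bounded solution are endpoints of nearby solutions for the same
input. -/
theorem JointlyLipschitzOnBoundedSets.exists_nearby_endpoint
    {f : StateSpace n → InputValue m → StateSpace n}
    (hf : JointlyLipschitzOnBoundedSets f) (B c : ℝ) :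
    ∃ L : ℝ, 0 < L ∧ ∀ (u : Input m) (x y : StateSpace n) (T : ℝ) (ξ : ℝ → StateSpace n),
      ‖u‖ ≤ c → 0 ≤ T → IsSolutionUpTo f x u T ξ → (∀ r ∈ Icc 0 T, ‖ξ r‖ ≤ B) →
      ‖ξ T - y‖ * Real.exp (L * T) ≤ 1 →
      ∃ z ζ, IsSolutionUpTo f z u T ζ ∧ ζ T = y ∧
        ‖x - z‖ ≤ ‖ξ T - y‖ * Real.exp (L * T) := by
  have hneg : JointlyLipschitzOnBoundedSets (fun x v => -f x v) := fun C hC => by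
    obtain ⟨L, hL, h⟩ := hf C hC
    refine ⟨L, hL, fun x₁ x₂ u₁ u₂ h1 h2 h3 h4 => ?_⟩
    rw [neg_sub_neg, norm_sub_rev]
    exact h _ _ _ _ h1 h2 h3 h4
  -- Continuous dependence on the initial state for the reversed system `-f` is continuous
  -- dependence of the starting point on the endpoint for `f`.
  obtain ⟨L, hL, h⟩ := hneg.exists_nearby B c
  refine ⟨L, hL, fun u x y T ξ hu hT hξ hξB hsmall => ?_⟩
  obtain ⟨v, hv, hvn⟩ := exists_reverse u (T := T)
  obtain ⟨ζ, hζ, hd⟩ := h v (ξ T) y T _ (hvn.trans hu) hT (hξ.reverse hf.continuous hT hv)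
    (fun r hr => hξB _ ⟨by linarith [hr.2], by linarith [hr.1]⟩) hsmall
  have hv' : ∀ᵐ r ∂(volume.restrict (Icc (0 : ℝ) T)), u r = v (T - r) := by
    rw [ae_restrict_iff' measurableSet_Icc] at hv ⊢
    have := (Measure.measurePreserving_sub_left (volume : Measure ℝ) T).quasiMeasurePreserving.ae hv
    filter_upwards [this] with r hr hmem
    rw [hr ⟨by linarith [hmem.2], by linarith [hmem.1]⟩, sub_sub_cancel]
  have hrev := hζ.reverse hneg.continuous hT hv'
  simp only [neg_neg] at hrev
  refine ⟨ζ T, _, hrev, ?_, ?_⟩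
  · simp [hζ.apply_zero hT]
  · have := hd T ⟨hT, le_rfl⟩
    simpa [hξ.apply_zero hT] using this

end Existence

/-! ### Forward completeness implies bounded reachability sets -/

section BoundedReachability

variable {n m : ℕ}

theorem flow_zero {f : StateSpace n → InputValue m → StateSpace n}
    (hf : JointlyLipschitzOnBoundedSets f) (hc : ForwardComplete f) (x : StateSpace n)
    (u : Input m) : flow f 0 x u = x :=
  (hc.isSolutionUpTo hf x u le_rfl).apply_zero le_rfl

theorem flow_congr_input {f : StateSpace n → InputValue m → StateSpace n}
    (hf : JointlyLipschitzOnBoundedSets f) (hc : ForwardComplete f) (x : StateSpace n)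
    {u v : Input m} {t : ℝ} (ht : 0 ≤ t)
    (huv : ∀ᵐ r ∂(volume.restrict (Ici (0 : ℝ))), r < t → u r = v r) :
    flow f t x u = flow f t x v := by
  have hne : ∀ᵐ r : ℝ, r ≠ t := by simp [ae_iff]
  refine ((hc.isSolutionUpTo hf x v ht).congr hf.continuous (v := u) ht ?_).flow_eq hf
    ⟨ht, le_rfl⟩
  filter_upwards [ae_restrict_Icc_of_ae_restrict_Ici huv le_rfl t, ae_restrict_of_ae hne,
    ae_restrict_mem measurableSet_Icc] with r hr hrt hmem
  rw [hr (lt_of_le_of_ne hmem.2 hrt)]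

theorem flow_concat {f : StateSpace n → InputValue m → StateSpace n}
    (hf : JointlyLipschitzOnBoundedSets f) (hc : ForwardComplete f) (x : StateSpace n)
    {u v w : Input m} {s t : ℝ} (hs : 0 ≤ s) (ht : 0 ≤ t)
    (hw : ∀ᵐ r ∂(volume.restrict (Ici (0 : ℝ))), w r = if r < s then u r else v (r - s)) :
    flow f (s + t) x w = flow f t (flow f s x u) v := by
  rw [((hc.isSolutionUpTo hf x u hs).concat hf.continuous hs ht
    (hc.isSolutionUpTo hf (flow f s x u) v ht) hw).flow_eq hf ⟨add_nonneg hs ht, le_rfl⟩]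
  split_ifs with h
  · have : t = 0 := by linarith
    subst this
    rw [flow_zero hf hc, add_zero]
  · rw [add_sub_cancel_left]

theorem flow_shift {f : StateSpace n → InputValue m → StateSpace n}
    (hf : JointlyLipschitzOnBoundedSets f) (hc : ForwardComplete f) (x : StateSpace n)
    {u v : Input m} {s t : ℝ} (hs : 0 ≤ s) (ht : 0 ≤ t)
    (hv : ∀ᵐ r ∂(volume.restrict (Ici (0 : ℝ))), v r = u (s + r)) :
    flow f t (flow f s x u) v = flow f (s + t) x u :=
  ((hc.isSolutionUpTo hf x u (add_nonneg hs ht)).shift hf.continuous hs ht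
    (ae_restrict_Icc_of_ae_restrict_Ici hv le_rfl t)).flow_eq hf ⟨ht, le_rfl⟩

theorem continuous_flow_state {f : StateSpace n → InputValue m → StateSpace n}
    (hf : JointlyLipschitzOnBoundedSets f) (hc : ForwardComplete f) (u : Input m) {t : ℝ}
    (ht : 0 ≤ t) : Continuous fun x => flow f t x u := by
  rw [continuous_iff_continuousAt]
  intro x
  have hx := hc.isSolutionUpTo hf x u ht
  obtain ⟨B, hB⟩ := isCompact_Icc.exists_bound_of_continuousOn hx.continuousOn
  obtain ⟨L, hL, h⟩ := hf.exists_nearby B ‖u‖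
  have hlim : Tendsto (fun y => ‖x - y‖ * Real.exp (L * t)) (𝓝 x) (𝓝 0) := by
    have : Continuous (fun y => ‖x - y‖ * Real.exp (L * t)) := by fun_prop
    simpa using this.tendsto x
  rw [ContinuousAt, tendsto_iff_norm_sub_tendsto_zero]
  refine squeeze_zero' (Eventually.of_forall fun _ => norm_nonneg _) ?_ hlim
  filter_upwards [hlim.eventually_le_const zero_lt_one] with y hy
  obtain ⟨ζ, hζ, hd⟩ := h u x y t _ le_rfl ht hx hB hy
  rw [norm_sub_rev, hζ.flow_eq hf ⟨ht, le_rfl⟩]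
  exact hd t ⟨ht, le_rfl⟩

/-- Trajectories for inputs of norm at most `c` which start arbitrarily close to `y` become
arbitrarily large within times arbitrarily little above `τ`. -/
def UnboundedReachNear (f : StateSpace n → InputValue m → StateSpace n) (c : ℝ)
    (y : StateSpace n) (τ : ℝ) : Prop :=
  ∀ ε : ℝ, 0 < ε → ∀ M : ℝ, ∃ (z : StateSpace n) (u : Input m) (r : ℝ),
    ‖z - y‖ < ε ∧ ‖u‖ ≤ c ∧ 0 ≤ r ∧ r ≤ τ + ε ∧ M < ‖flow f r z u‖

theorem UnboundedReachNear.nonneg {f : StateSpace n → InputValue m → StateSpace n} {c : ℝ}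
    {y : StateSpace n} {τ : ℝ} (h : UnboundedReachNear f c y τ) : 0 ≤ τ := by
  by_contra! hτ
  obtain ⟨_, _, r, _, _, h0, h1, _⟩ := h (-τ / 2) (by linarith) 0
  linarith

theorem UnboundedReachNear.mono {f : StateSpace n → InputValue m → StateSpace n} {c : ℝ}
    {y : StateSpace n} {τ τ' : ℝ} (h : UnboundedReachNear f c y τ) (hτ : τ ≤ τ') :
    UnboundedReachNear f c y τ' := fun ε hε M => by
  obtain ⟨z, u, r, h1, h2, h3, h4, h5⟩ := h ε hε M
  exact ⟨z, u, r, h1, h2, h3, by linarith, h5⟩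

/-- Trajectories that become large cross the sphere of radius `R`. Near a limit point of their first
crossing points, the remaining pieces still become arbitrarily large, and a small change of one
initial state makes its trajectory meet that limit point exactly. -/
theorem UnboundedReachNear.exists_sphere {f : StateSpace n → InputValue m → StateSpace n}
    (hf : JointlyLipschitzOnBoundedSets f) (hc : ForwardComplete f) {c : ℝ}
    {y : StateSpace n} {τ R δ : ℝ} (h : UnboundedReachNear f c y τ) (hR : ‖y‖ < R)
    (hδ : 0 < δ) :
    ∃ (z : StateSpace n) (u : Input m) (σ : ℝ), 0 ≤ σ ∧ ‖u‖ ≤ c ∧ ‖z - y‖ < δ ∧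
      ‖flow f σ z u‖ = R ∧ UnboundedReachNear f c (flow f σ z u) (τ + δ - σ) := by
  -- The second entry keeps the starting points inside the ball of radius `R`, as a first hitting
  -- time requires.
  have hε : ∀ j : ℕ, 0 < min (1 / ((j : ℝ) + 1)) (R - ‖y‖) := fun j =>
    lt_min (by positivity) (sub_pos.2 hR)
  choose z u r hz hu hr0 hr hM using fun j : ℕ => h _ (hε j) (max R j)
  have hr' : ∀ j, r j ≤ τ + 1 / ((j : ℝ) + 1) := fun j =>
    (hr j).trans (by linarith [min_le_left (1 / ((j : ℝ) + 1)) (R - ‖y‖)])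
  have hzy : ∀ j, ‖z j - y‖ < 1 / ((j : ℝ) + 1) := fun j => (hz j).trans_le (min_le_left _ _)
  have hzR : ∀ j, ‖z j‖ ≤ R := fun j => by
    have h1 := (hz j).trans_le (min_le_right _ _)
    have h2 := norm_sub_norm_le (z j) y
    linarith
  have hfirst : ∀ j, ∃ σ ∈ Icc 0 (r j), ‖flow f σ (z j) (u j)‖ = R ∧
      ∀ s ∈ Icc 0 σ, ‖flow f s (z j) (u j)‖ ≤ R := fun j =>
    exists_first_hit (hc.isSolutionUpTo hf (z j) (u j) (hr0 j)).continuousOn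
      (by rw [flow_zero hf hc]; exact hzR j) ⟨hr0 j, le_rfl⟩
      ((le_max_left _ _).trans (hM j).le)
  choose σ hσ hσR hσle using hfirst
  have hinv : ∀ j : ℕ, 1 / ((j : ℝ) + 1) ≤ 1 := fun j => by
    rw [div_le_one (by positivity)]; linarith [(Nat.cast_nonneg j : (0 : ℝ) ≤ j)]
  have hσ1 : ∀ j, σ j ≤ τ + 1 := fun j =>
    (hσ j).2.trans ((hr' j).trans (by linarith [hinv j]))
  have hmem : ∀ j, (flow f (σ j) (z j) (u j), σ j) ∈
      Metric.sphere (0 : StateSpace n) R ×ˢ Icc 0 (τ + 1) := fun j =>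
    ⟨by simpa using hσR j, (hσ j).1, hσ1 j⟩
  obtain ⟨⟨y', σ'⟩, hy', φ, hφ, hlim⟩ :=
    ((isCompact_sphere (0 : StateSpace n) R).prod isCompact_Icc).tendsto_subseq hmem
  have hlim1 : Tendsto (fun k => ‖flow f (σ (φ k)) (z (φ k)) (u (φ k)) - y'‖) atTop (𝓝 0) :=
    tendsto_iff_norm_sub_tendsto_zero.1 ((continuous_fst.tendsto _).comp hlim)
  have hlim2 : Tendsto (fun k => |σ (φ k) - σ'|) atTop (𝓝 0) :=
    tendsto_iff_norm_sub_tendsto_zero.1 ((continuous_snd.tendsto _).comp hlim)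
  have hlim3 : Tendsto (fun k => 1 / ((φ k : ℝ) + 1)) atTop (𝓝 0) :=
    (tendsto_one_div_add_atTop_nhds_zero_nat (𝕜 := ℝ)).comp hφ.tendsto_atTop
  have hlim4 : Tendsto (fun k => (φ k : ℝ)) atTop atTop :=
    tendsto_natCast_atTop_atTop.comp hφ.tendsto_atTop
  obtain ⟨L, hL, hend⟩ := hf.exists_nearby_endpoint R c
  have hlim5 : Tendsto (fun k => ‖flow f (σ (φ k)) (z (φ k)) (u (φ k)) - y'‖ *
      Real.exp (L * (τ + 1))) atTop (𝓝 0) := by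
    simpa using hlim1.mul_const (Real.exp (L * (τ + 1)))
  -- A single late index supplies the input and the time. Of the two halves of `δ` in space, one
  -- pays for the distance of its initial state from `y`, the other for the correction of that
  -- state.
  obtain ⟨k, hk1, hk2, hk3, hk5⟩ := ((hlim5.eventually_lt_const (half_pos hδ)).and
    ((hlim2.eventually_lt_const (half_pos hδ)).and ((hlim3.eventually_lt_const
      (half_pos hδ)).and (hlim5.eventually_le_const zero_lt_one)))).exists
  set J := φ k with hJ
  have hexp : ‖flow f (σ J) (z J) (u J) - y'‖ * Real.exp (L * σ J) ≤
      ‖flow f (σ J) (z J) (u J) - y'‖ * Real.exp (L * (τ + 1)) :=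
    mul_le_mul_of_nonneg_left
      (Real.exp_le_exp.2 (mul_le_mul_of_nonneg_left (hσ1 J) hL.le)) (norm_nonneg _)
  obtain ⟨z', ζ, hζ, hζy, hzz⟩ := hend (u J) (z J) y' (σ J) _ (hu J) (hσ J).1
    (hc.isSolutionUpTo hf (z J) (u J) (hσ J).1) (hσle J) (hexp.trans hk5)
  have hflow : flow f (σ J) z' (u J) = y' := by
    rw [hζ.flow_eq hf ⟨(hσ J).1, le_rfl⟩, hζy]
  refine ⟨z', u J, σ J, (hσ J).1, hu J, ?_, ?_, ?_⟩
  · have h1 := hzy J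
    have h2 : ‖z' - y‖ ≤ ‖z J - z'‖ + ‖z J - y‖ := by
      have : z' - y = -(z J - z') + (z J - y) := by abel
      rw [this, ← norm_neg (z J - z')]
      exact norm_add_le _ _
    linarith
  · rw [hflow]; simpa using hy'.1
  · rw [hflow]
    intro ε hε M
    -- The witnesses are the tails of still later trajectories. Their first hitting times differ
    -- from `σ J` by less than `δ`, which is the extra time allowed in the conclusion.
    obtain ⟨i, hi1, hi2, hi3, hi4⟩ := ((hlim1.eventually_lt_const hε).and
      ((hlim2.eventually_lt_const (half_pos hδ)).and ((hlim3.eventually_lt_const hε).and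
        (hlim4.eventually_ge_atTop M)))).exists
    obtain ⟨v, hv, hvn⟩ := exists_shift (u (φ i)) (hσ (φ i)).1
    have hnn : 0 ≤ r (φ i) - σ (φ i) := sub_nonneg.2 (hσ (φ i)).2
    refine ⟨_, v, r (φ i) - σ (φ i), hi1, hvn.trans (hu _), hnn, ?_, ?_⟩
    · have h1 := hr' (φ i)
      have h2 := (abs_lt.1 hk2).2
      have h3 := (abs_lt.1 hi2).1
      linarith
    · rw [flow_shift hf hc _ (hσ (φ i)).1 hnn hv, add_sub_cancel]
      exact hi4.trans_lt ((le_max_right _ _).trans_lt (hM _))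

/-- Extension of an input, and perturbation of the initial state, so that the trajectory becomes
large while trajectories starting nearby can still be made arbitrarily large. -/
theorem UnboundedReachNear.exists_extension {f : StateSpace n → InputValue m → StateSpace n}
    (hf : JointlyLipschitzOnBoundedSets f) (hc : ForwardComplete f) {c T : ℝ}
    {z : StateSpace n} {w : Input m} {s ρ : ℝ} (hw : ‖w‖ ≤ c) (hs : 0 ≤ s) (hρ : 0 < ρ)
    (h : UnboundedReachNear f c (flow f s z w) (T - s - ρ)) (M : ℝ) :
    ∃ (z' : StateSpace n) (w' : Input m) (s' ρ' : ℝ), ‖w'‖ ≤ c ∧ s ≤ s' ∧ 0 < ρ' ∧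
      UnboundedReachNear f c (flow f s' z' w') (T - s' - ρ') ∧
      Metric.closedBall z' ρ' ⊆ Metric.closedBall z ρ ∧
      (∀ᵐ r ∂(volume.restrict (Ici (0 : ℝ))), r < s → w' r = w r) ∧
      ∀ q ∈ Metric.closedBall z' ρ', M < ‖flow f s' q w'‖ := by
  have hz := hc.isSolutionUpTo hf z w hs
  obtain ⟨B, hB⟩ := isCompact_Icc.exists_bound_of_continuousOn hz.continuousOn
  obtain ⟨L, hL, hend⟩ := hf.exists_nearby_endpoint B c
  set R := max M ‖flow f s z w‖ + 1 with hR
  -- The number `ρ` is both a radius for initial states and a reserve of time. The factor `exp(-(L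
  -- s))` compensates the backward transport from time `s` to time 0, so the initial state moves by
  -- at most `ρ / 2`; also `δ ≤ ρ / 2` leaves half of the time reserve.
  set δ := min 1 (ρ / 2) * Real.exp (-(L * s)) with hδ
  have hmin : 0 < min 1 (ρ / 2) := lt_min one_pos (half_pos hρ)
  have hδ0 : 0 < δ := mul_pos hmin (Real.exp_pos _)
  have hδexp : δ * Real.exp (L * s) = min 1 (ρ / 2) := by
    rw [hδ, mul_assoc, ← Real.exp_add]; simp
  have hδρ : δ ≤ ρ / 2 := by
    refine (mul_le_of_le_one_right hmin.le ?_).trans (min_le_right _ _)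
    rw [Real.exp_le_one_iff]
    exact neg_nonpos.2 (mul_nonneg hL.le hs)
  obtain ⟨z₁, u, σ, hσ, hu, hz₁, hzR, hbad⟩ := h.exists_sphere hf hc
    (R := R) (by rw [hR]; linarith [le_max_right M ‖flow f s z w‖]) hδ0
  have hle : ‖flow f s z w - z₁‖ * Real.exp (L * s) ≤ min 1 (ρ / 2) := by
    rw [← hδexp, norm_sub_rev]
    exact mul_le_mul_of_nonneg_right hz₁.le (Real.exp_pos _).le
  obtain ⟨z', ζ, hζ, hζy, hzz⟩ := hend w z z₁ s _ hw hs hz hB (hle.trans (min_le_left _ _))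
  have hz'z : ‖z - z'‖ ≤ ρ / 2 := hzz.trans (hle.trans (min_le_right _ _))
  have hflow : flow f s z' w = z₁ := by rw [hζ.flow_eq hf ⟨hs, le_rfl⟩, hζy]
  obtain ⟨w', hw', hw'n⟩ := exists_concat w u (s := s) hw hu
  have hflow' : flow f (s + σ) z' w' = flow f σ z₁ u := by
    rw [flow_concat hf hc z' hs hσ hw', hflow]
  have hs' : 0 ≤ s + σ := add_nonneg hs hσ
  have hMlt : M < ‖flow f (s + σ) z' w'‖ := by
    rw [hflow', hzR, hR]; linarith [le_max_left M ‖flow f s z w‖]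
  -- Largeness is an open condition on the initial state, so it holds on a whole ball and survives
  -- all later corrections.
  have hev : ∀ᶠ q in 𝓝 z', M < ‖flow f (s + σ) q w'‖ :=
    ((continuous_flow_state hf hc w' hs').norm.tendsto z').eventually_const_lt hMlt
  obtain ⟨ρ₁, hρ₁, hball⟩ := Metric.eventually_nhds_iff.1 hev
  refine ⟨z', w', s + σ, min (ρ₁ / 2) (ρ / 2), hw'n, by linarith,
    lt_min (half_pos hρ₁) (half_pos hρ), ?_, ?_, ?_, ?_⟩
  · rw [hflow']
    refine hbad.mono ?_
    have := min_le_right (ρ₁ / 2) (ρ / 2)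
    linarith
  · refine Metric.closedBall_subset_closedBall' ?_
    rw [dist_comm, dist_eq_norm]
    linarith [min_le_right (ρ₁ / 2) (ρ / 2)]
  · filter_upwards [hw'] with r hr hrs
    rw [hr, if_pos hrs]
  · intro q hq
    refine hball (lt_of_le_of_lt (Metric.mem_closedBall.1 hq) ?_)
    exact (min_le_left _ _).trans_lt (by linarith)

/-- A sequence of inputs each of which extends the previous one has a common extension. -/
theorem exists_glued_input {c : ℝ} (w : ℕ → Input m) (s : ℕ → ℝ) (hw : ∀ k, ‖w k‖ ≤ c)
    (hs : Monotone s)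
    (hext : ∀ k, ∀ᵐ r ∂(volume.restrict (Ici (0 : ℝ))), r < s k → w (k + 1) r = w k r) :
    ∃ v : Input m, ∀ k, ∀ᵐ r ∂(volume.restrict (Ici (0 : ℝ))), r < s k → v r = w k r := by
  classical
  have hall : ∀ᵐ r ∂(volume.restrict (Ici (0 : ℝ))), ∀ k, r < s k → ∀ j, k ≤ j →
      w j r = w k r := by
    filter_upwards [ae_all_iff.2 hext] with r hr k hk j hj
    induction j, hj using Nat.le_induction with
    | base => rfl
    | succ j hj ih => rw [hr j (hk.trans_le (hs hj)), ih]
  set g : ℝ → InputValue m := fun r => if h : ∃ k, r < s k then w (Nat.find h) r else 0 with hg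
  have hgw : ∀ᵐ r ∂(volume.restrict (Ici (0 : ℝ))), ∀ k, r < s k → g r = w k r := by
    filter_upwards [hall] with r hr k hk
    have h : ∃ k, r < s k := ⟨k, hk⟩
    rw [hg]
    simp only
    rw [dif_pos h]
    exact (hr _ (Nat.find_spec h) k (Nat.find_min' h hk)).symm
  have hmeas : AEStronglyMeasurable g (volume.restrict (Ici (0 : ℝ))) := by
    refine aestronglyMeasurable_of_tendsto_ae atTop
      (f := fun (k : ℕ) (r : ℝ) => if r < s k then w k r else 0)
      (fun k => (StronglyMeasurable.ite measurableSet_Iio (Lp.stronglyMeasurable (w k))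
        stronglyMeasurable_const).aestronglyMeasurable) ?_
    filter_upwards [hgw] with r hr
    refine tendsto_nhds_of_eventually_eq ?_
    by_cases h : ∃ k, r < s k
    · obtain ⟨k, hk⟩ := h
      filter_upwards [eventually_ge_atTop k] with j hj
      have hrj := hk.trans_le (hs hj)
      rw [if_pos hrj, hr j hrj]
    · refine Eventually.of_forall fun j => ?_
      rw [if_neg fun hj => h ⟨j, hj⟩, hg]
      simp only
      rw [dif_neg h]
  obtain ⟨v, hv, -⟩ := exists_input ((norm_nonneg _).trans (hw 0)) hmeas (by
    filter_upwards [hgw, ae_all_iff.2 fun k => ae_norm_le_norm_input (w k)] with r hr hb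
    by_cases h : ∃ k, r < s k
    · obtain ⟨k, hk⟩ := h
      rw [hr k hk]
      exact (hb k).trans (hw k)
    · rw [hg]
      simp only
      rw [dif_neg h, norm_zero]
      exact (norm_nonneg _).trans (hw 0))
  refine ⟨v, fun k => ?_⟩
  filter_upwards [hv, hgw] with r h1 h2 hk
  rw [h1, h2 k hk]

/-- A nested-ball argument in the style of Baire: infinitely many extensions, the `k`-th one forcing
norm above `k` on an entire ball of initial states, produce one state and one input whose trajectory
is unbounded before time `T`. -/
theorem not_unboundedReachNear {f : StateSpace n → InputValue m → StateSpace n}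
    (hf : JointlyLipschitzOnBoundedSets f) (hc : ForwardComplete f) {c : ℝ} (hc0 : 0 ≤ c)
    (y : StateSpace n) (τ : ℝ) : ¬ UnboundedReachNear f c y τ := by
  intro h
  set T := τ + 1 with hT
  let S := {p : StateSpace n × Input m × ℝ × ℝ // ‖p.2.1‖ ≤ c ∧ 0 ≤ p.2.2.1 ∧ 0 < p.2.2.2 ∧
    UnboundedReachNear f c (flow f p.2.2.1 p.1 p.2.1) (T - p.2.2.1 - p.2.2.2)}
  have hstep : ∀ (p : S) (M : ℝ), ∃ p' : S, p.1.2.2.1 ≤ p'.1.2.2.1 ∧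
      Metric.closedBall p'.1.1 p'.1.2.2.2 ⊆ Metric.closedBall p.1.1 p.1.2.2.2 ∧
      (∀ᵐ r ∂(volume.restrict (Ici (0 : ℝ))), r < p.1.2.2.1 → p'.1.2.1 r = p.1.2.1 r) ∧
      ∀ q ∈ Metric.closedBall p'.1.1 p'.1.2.2.2, M < ‖flow f p'.1.2.2.1 q p'.1.2.1‖ := by
    rintro ⟨⟨z, w, s, ρ⟩, hw, hs, hρ, hbad⟩ M
    obtain ⟨z', w', s', ρ', h1, h2, h3, h4, h5, h6, h7⟩ :=
      hbad.exists_extension hf hc hw hs hρ M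
    exact ⟨⟨⟨z', w', s', ρ'⟩, h1, hs.trans h2, h3, h4⟩, h2, h5, h6, h7⟩
  choose F hF1 hF2 hF3 hF4 using hstep
  -- The initial reserve 1 is what separates `T` from `τ`.
  let p₀ : S := ⟨⟨y, 0, 0, 1⟩, by simpa using hc0, le_rfl, one_pos, by
    simp only
    rw [flow_zero hf hc]
    exact h.mono (by linarith)⟩
  let p : ℕ → S := fun k => Nat.rec p₀ (fun k q => F q k) k
  have hp : ∀ k, p (k + 1) = F (p k) k := fun k => rfl
  obtain ⟨q, hq⟩ := IsCompact.nonempty_iInter_of_sequence_nonempty_isCompact_isClosed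
    (fun k => Metric.closedBall (p k).1.1 (p k).1.2.2.2)
    (fun k => by rw [hp]; exact hF2 _ _)
    (fun k => Metric.nonempty_closedBall.2 (p k).2.2.2.1.le)
    (isCompact_closedBall _ _) (fun k => Metric.isClosed_closedBall)
  rw [mem_iInter] at hq
  obtain ⟨v, hv⟩ := exists_glued_input (fun k => (p k).1.2.1) (fun k => (p k).1.2.2.1)
    (fun k => (p k).2.1) (monotone_nat_of_le_succ fun k => by rw [hp]; exact hF1 _ _)
    (fun k => by rw [hp]; exact hF3 _ _)
  have hT0 : 0 ≤ T := by linarith [h.nonneg]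
  obtain ⟨B, hB⟩ := isCompact_Icc.exists_bound_of_continuousOn
    (hc.isSolutionUpTo hf q v hT0).continuousOn
  obtain ⟨k, hk⟩ := exists_nat_ge B
  have hs0 := (p (k + 1)).2.2.1
  have hsT : (p (k + 1)).1.2.2.1 ≤ T := by
    linarith [(p (k + 1)).2.2.2.2.nonneg, (p (k + 1)).2.2.2.1]
  have h1 := hB _ ⟨hs0, hsT⟩
  have h2 : (k : ℝ) < ‖flow f (p (k + 1)).1.2.2.1 q (p (k + 1)).1.2.1‖ := by
    have := hq (k + 1)
    rw [hp] at this ⊢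
    exact hF4 _ _ q this
  rw [flow_congr_input hf hc q hs0 (hv (k + 1))] at h1
  linarith

theorem ForwardComplete.hasBRS {f : StateSpace n → InputValue m → StateSpace n}
    (hf : JointlyLipschitzOnBoundedSets f) (hc : ForwardComplete f) : HasBRS f := by
  refine ⟨hc, fun C τ hC hτ => ?_⟩
  by_contra hbdd
  rw [not_bddAbove_iff] at hbdd
  have hseq : ∀ j : ℕ, ∃ (x : StateSpace n) (u : Input m) (t : ℝ),
      ‖x‖ < C ∧ ‖u‖ < C ∧ 0 ≤ t ∧ t < τ ∧ (j : ℝ) < ‖flow f t x u‖ := fun j => by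
    obtain ⟨_, ⟨x, u, t, hx, hu, ht0, ht, rfl⟩, hj⟩ := hbdd j
    exact ⟨x, u, t, hx, hu, ht0, ht, hj⟩
  choose x u t hx hu ht0 ht hj using hseq
  obtain ⟨y, -, φ, hφ, hlim⟩ := (isCompact_closedBall (0 : StateSpace n) C).tendsto_subseq
    (x := x) fun j => by simpa using (hx j).le
  refine not_unboundedReachNear hf hc hC.le y τ fun ε hε M => ?_
  have hlim4 : Tendsto (fun k => (φ k : ℝ)) atTop atTop :=
    tendsto_natCast_atTop_atTop.comp hφ.tendsto_atTop
  obtain ⟨k, hk1, hk2⟩ := (((tendsto_iff_norm_sub_tendsto_zero.1 hlim).eventually_lt_const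
    hε).and (hlim4.eventually_ge_atTop M)).exists
  exact ⟨x (φ k), u (φ k), t (φ k), hk1, (hu _).le, ht0 _, by linarith [ht (φ k)],
    hk2.trans_lt (hj _)⟩

end BoundedReachability

/-! ### Existence of a BRS Lyapunov function implies forward completeness -/

section LyapunovToCompleteness

variable {n m : ℕ}

/-- By the cocycle property, the Dini derivative of `V ∘ ξ` at time `s` is the Lie derivative at `ξ
s` for the shifted input. The conclusion has the form that the Grönwall comparison theorem consumes.
-/
theorem IsSolutionUpTo.frequently_slope_lt {f : StateSpace n → InputValue m → StateSpace n}
    (hf : JointlyLipschitzOnBoundedSets f) {V : StateSpace n → ℝ≥0} {x : StateSpace n}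
    {u v : Input m} {t s : ℝ} {ξ : ℝ → StateSpace n} (hξ : IsSolutionUpTo f x u t ξ)
    (hs : s ∈ Ico 0 t) (hv : ∀ᵐ r ∂(volume.restrict (Ici (0 : ℝ))), v r = u (s + r))
    (hV : lieDerivative f V v (ξ s) ≤ ((V (ξ s) : ℝ) : EReal)) {r : ℝ}
    (hr : (V (ξ s) : ℝ) < r) :
    ∃ᶠ z in 𝓝[>] s, (z - s)⁻¹ * ((V (ξ z) : ℝ) - V (ξ s)) < r := by
  have hlt : lieDerivative f V v (ξ s) < (r : EReal) :=
    hV.trans_lt (EReal.coe_lt_coe_iff.2 hr)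
  have hev := eventually_lt_of_limsup_lt hlt
  have htend : Tendsto (fun z => z - s) (𝓝[>] s) (𝓝[>] (0 : ℝ)) := by
    refine tendsto_nhdsWithin_iff.2 ⟨?_, ?_⟩
    · have : Tendsto (fun z => z - s) (𝓝 s) (𝓝 (s - s)) :=
        (continuous_id.sub continuous_const).tendsto s
      rw [sub_self] at this
      exact this.mono_left nhdsWithin_le_nhds
    · filter_upwards [self_mem_nhdsWithin] with z hz
      exact mem_Ioi.2 (sub_pos.2 (mem_Ioi.1 hz))
  refine Eventually.frequently ?_
  filter_upwards [htend.eventually hev, Ioo_mem_nhdsGT hs.2] with z hz hzt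
  have hsol : IsSolutionUpTo f (ξ s) v (t - s) (fun q => ξ (s + q)) :=
    IsSolutionUpTo.shift hf.continuous (by rwa [add_sub_cancel]) hs.1 (by linarith [hs.2])
      (ae_restrict_Icc_of_ae_restrict_Ici hv le_rfl _)
  rw [hsol.flow_eq hf ⟨by linarith [hzt.1], by linarith [hzt.2]⟩, EReal.coe_lt_coe_iff,
    add_sub_cancel] at hz
  rwa [inv_mul_eq_div]

theorem IsBRSLyapunovFunction.forwardComplete
    {f : StateSpace n → InputValue m → StateSpace n} (hf : JointlyLipschitzOnBoundedSets f)
    {V : StateSpace n → ℝ≥0} (hV : IsBRSLyapunovFunction f V) : ForwardComplete f := by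
  intro x u T hT
  obtain ⟨α₁, α₂, hα₁, hα₂, C, hsand⟩ := hV.sandwich
  obtain ⟨χ, hχ, hgrowth⟩ := hV.growth
  set R : ℝ≥0 := max ‖x‖₊ (χ ‖u‖₊) with hR
  set M : ℝ≥0 := α₂ R + C with hM
  -- Since `α₁(B) > M exp(T)`, a bound for `V` along the solution becomes the norm bound `B`.
  obtain ⟨_, ⟨B, rfl⟩, hB⟩ := not_bddAbove_iff.1 hα₁.unbounded
    ((M * Real.toNNReal (Real.exp T)))
  refine ⟨hT, exists_isSolutionUpTo_of_bound hf x u hT (B := B) fun t ht ξ hξ => ?_⟩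
  suffices h : (V (ξ t) : ℝ) ≤ M * Real.exp T by
    by_contra! hlt
    have h1 : B < ‖ξ t‖₊ := by rw [← NNReal.coe_lt_coe]; simpa using hlt
    have h2 := (hB.trans (hα₁.strictMono h1)).trans_le (hsand (ξ t)).1
    rw [← NNReal.coe_lt_coe, NNReal.coe_mul, Real.coe_toNNReal _ (Real.exp_pos _).le] at h2
    linarith
  have hMV : ∀ y : StateSpace n, ‖y‖₊ ≤ R → (V y : ℝ) ≤ M := fun y hy => by
    rw [NNReal.coe_le_coe]
    refine (hsand y).2.trans ?_
    rw [hM]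
    gcongr
    exact hα₂.strictMono.monotone hy
  have hn : ContinuousOn (fun s => ‖ξ s‖₊) (Icc 0 t) := hξ.continuousOn.nnnorm
  have hAc : IsCompact (Icc 0 t ∩ (fun s => ‖ξ s‖₊) ⁻¹' Iic R) :=
    isCompact_Icc.of_isClosed_subset (hn.preimage_isClosed_of_isClosed isClosed_Icc isClosed_Iic)
      inter_subset_left
  -- The last time in the ball of radius `R`. There `V ≤ M`, and from then on the state is large
  -- enough for the growth condition.
  obtain ⟨a, haA, ha⟩ := hAc.exists_isGreatest ⟨0, ⟨le_rfl, ht.1⟩, by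
    simpa only [mem_preimage, hξ.apply_zero ht.1] using
      mem_Iic.2 (le_max_left ‖x‖₊ (χ ‖u‖₊))⟩
  have hgt : ∀ s ∈ Ioc a t, R < ‖ξ s‖₊ := fun s hs => by
    by_contra! hle
    exact absurd (ha ⟨⟨haA.1.1.trans hs.1.le, hs.2⟩, hle⟩) (not_le.2 hs.1)
  have hge : ∀ s ∈ Ico a t, R ≤ ‖ξ s‖₊ := fun s hs => by
    rcases hs.1.eq_or_lt with h | h
    · subst h
      have hcl : a ∈ closure (Ioc a t) := by
        rw [closure_Ioc hs.2.ne]; exact ⟨le_rfl, hs.2.le⟩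
      have hcw : ContinuousWithinAt (fun s => ‖ξ s‖₊) (Ioc a t) a :=
        (hn a haA.1).mono fun r hr => ⟨haA.1.1.trans hr.1.le, hr.2⟩
      have := hcw.mem_closure hcl (t := Ici R) fun r hr => (hgt r hr).le
      simpa using this
    · exact (hgt s ⟨h, hs.2.le⟩).le
  have hsub : Icc a t ⊆ Icc 0 t := Icc_subset_Icc_left haA.1.1
  have key := le_gronwallBound_of_liminf_deriv_right_le (f := fun s => (V (ξ s) : ℝ))
    (f' := fun s => (V (ξ s) : ℝ)) (δ := M) (K := 1) (ε := 0) (a := a) (b := t)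
    ((NNReal.continuous_coe.comp hV.continuous).comp_continuousOn (hξ.continuousOn.mono hsub))
    (fun s hs r hr => by
      have hs0 : 0 ≤ s := haA.1.1.trans hs.1
      obtain ⟨v, hv, hvn⟩ := exists_shift u hs0
      refine hξ.frequently_slope_lt hf ⟨hs0, hs.2⟩ hv (hgrowth _ _ ?_) hr
      refine le_trans ?_ (hge s hs)
      exact (hχ.strictMono.monotone (show ‖v‖₊ ≤ ‖u‖₊ from hvn)).trans (le_max_right _ _))
    (hMV _ haA.2) (fun s _ => by simp) t ⟨haA.1.2, le_rfl⟩
  rw [gronwallBound_ε0, one_mul] at key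
  refine key.trans (mul_le_mul_of_nonneg_left (Real.exp_le_exp.2 ?_) M.2)
  linarith [haA.1.1, ht.2]

end LyapunovToCompleteness

/-! ### Level radii and the level function -/

section Levels

variable {n m : ℕ}

/-- The radii are defined recursively from the reachability bounds. The margins `R k + 1` and the
horizon 2 allow later use with non-strict bounds and times up to 1. -/
theorem HasBRS.exists_levels {f : StateSpace n → InputValue m → StateSpace n} (h : HasBRS f) :
    ∃ R : ℕ → ℝ, (∀ k : ℕ, (k : ℝ) + 3 ≤ R k) ∧ (∀ k, 2 * R k ≤ R (k + 1)) ∧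
      ∀ (k : ℕ) (x : StateSpace n) (u : Input m) (t : ℝ), ‖x‖ < R k + 1 → ‖u‖ < R k + 1 →
        0 ≤ t → t < 2 → ‖flow f t x u‖ < R (k + 1) := by
  have h2 : ∀ C : ℝ, 0 < C → ∃ M : ℝ, ∀ (x : StateSpace n) (u : Input m) (t : ℝ), ‖x‖ < C →
      ‖u‖ < C → 0 ≤ t → t < 2 → ‖flow f t x u‖ ≤ M := fun C hC => by
    obtain ⟨M, hM⟩ := h.2 C 2 hC zero_le_two
    exact ⟨M, fun x u t hx hu h0 ht => hM ⟨x, u, t, hx, hu, h0, ht, rfl⟩⟩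
  choose! M hM using h2
  let R : ℕ → ℝ := fun k => Nat.rec 3 (fun _ r => max (2 * r) (M (r + 1) + 1)) k
  have hR : ∀ k, R (k + 1) = max (2 * R k) (M (R k + 1) + 1) := fun k => rfl
  have hR3 : ∀ k : ℕ, (k : ℝ) + 3 ≤ R k := fun k => by
    induction k with
    | zero => simp [R]
    | succ k ih =>
      have h1 : 2 * R k ≤ R (k + 1) := by rw [hR]; exact le_max_left _ _
      push_cast
      linarith [(Nat.cast_nonneg k : (0 : ℝ) ≤ k)]
  refine ⟨R, hR3, fun k => by rw [hR]; exact le_max_left _ _, fun k x u t hx hu h0 ht => ?_⟩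
  have h1 := hM (R k + 1) (by linarith [hR3 k, (Nat.cast_nonneg k : (0 : ℝ) ≤ k)]) x u t hx hu h0 ht
  have h3 : M (R k + 1) + 1 ≤ R (k + 1) := by rw [hR]; exact le_max_right _ _
  linarith

/-- A `𝒦_∞` function which is `1`-Lipschitz and grows by one from one of the given radii to the
next. -/
theorem exists_level_function {R : ℕ → ℝ} (hR : ∀ k : ℕ, (k : ℝ) + 3 ≤ R k)
    (hR2 : ∀ k, 2 * R k ≤ R (k + 1)) :
    ∃ η : ℝ≥0 → ℝ≥0, ClassKInfty η ∧ (∀ r r', (η r : ℝ) ≤ η r' + |(r : ℝ) - r'|) ∧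
      (∀ (k : ℕ) (r : ℝ≥0), (r : ℝ) ≤ R k → (η r : ℝ) ≤ k + 1) ∧
      ∀ (k : ℕ) (r : ℝ≥0), R k ≤ r → (k : ℝ) ≤ η r := by
  have hR1 : ∀ k, 1 ≤ R k := fun k => by linarith [hR k, (Nat.cast_nonneg k : (0 : ℝ) ≤ k)]
  have hR0 : ∀ k, 0 < R k := fun k => zero_lt_one.trans_le (hR1 k)
  have hmono : Monotone R := monotone_nat_of_le_succ fun k => by linarith [hR2 k, hR0 k]
  -- The level function is the infimum of these affine functions, all of slope at most 1. The `k`-th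
  -- one is at most `k + 1` up to radius `R k`; since the radii double, the earlier ones have passed
  -- `k` by then.
  set a : ℝ≥0 → ℕ → ℝ := fun r k => k + (r : ℝ) / R k with ha
  have ha0 : ∀ r k, 0 ≤ a r k := fun r k =>
    add_nonneg (Nat.cast_nonneg k) (div_nonneg r.2 (hR0 k).le)
  have hbdd : ∀ r, BddBelow (range (a r)) := fun r =>
    ⟨0, by rintro _ ⟨k, rfl⟩; exact ha0 r k⟩
  have hle : ∀ r k, ⨅ j, a r j ≤ a r k := fun r k => ciInf_le (hbdd r) k
  have hnn : ∀ r, 0 ≤ ⨅ j, a r j := fun r => le_ciInf (ha0 r)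
  set η : ℝ≥0 → ℝ≥0 := fun r => ⟨⨅ j, a r j, hnn r⟩ with hη
  have hηle : ∀ r k, (η r : ℝ) ≤ a r k := hle
  have hηge : ∀ r (b : ℝ), (∀ k, b ≤ a r k) → b ≤ η r := fun r b h => le_ciInf h
  have hlow : ∀ (k : ℕ) (r : ℝ≥0), R k ≤ r → (k : ℝ) ≤ η r := fun k r hr => by
    refine hηge _ _ fun j => ?_
    rcases le_total k j with hkj | hjk
    · have h1 : (k : ℝ) ≤ j := by exact_mod_cast hkj
      have h2 : 0 ≤ (r : ℝ) / R j := div_nonneg r.2 (hR0 j).le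
      simp only [ha]
      linarith
    · obtain ⟨i, rfl⟩ := Nat.exists_eq_add_of_le hjk
      have hpow : ∀ i : ℕ, ((i : ℝ) + 1) * R j ≤ R (j + i) := fun i => by
        induction i with
        | zero => simp
        | succ i ih =>
          have h1 := hR2 (j + i)
          have h2 : 0 ≤ (i : ℝ) * R j := mul_nonneg (Nat.cast_nonneg i) (hR0 j).le
          push_cast
          rw [← add_assoc]
          linarith
      have h1 : (i : ℝ) + 1 ≤ r / R j := by
        rw [le_div_iff₀ (hR0 j)]
        exact (hpow i).trans hr
      simp only [ha]
      push_cast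
      linarith
  have hup : ∀ (k : ℕ) (r : ℝ≥0), (r : ℝ) ≤ R k → (η r : ℝ) ≤ k + 1 := fun k r hr => by
    refine (hηle r k).trans ?_
    have : (r : ℝ) / R k ≤ 1 := (div_le_one (hR0 k)).2 hr
    simp only [ha]
    linarith
  have hlip : ∀ r r', (η r : ℝ) ≤ η r' + |(r : ℝ) - r'| := fun r r' => by
    rw [← sub_le_iff_le_add]
    refine hηge _ _ fun k => ?_
    rw [sub_le_iff_le_add]
    refine (hηle r k).trans ?_
    have h1 : ((r : ℝ) - r') / R k ≤ |(r : ℝ) - r'| :=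
      (div_le_div_of_nonneg_right (le_abs_self _) (hR0 k).le).trans
        (div_le_self (abs_nonneg _) (hR1 k))
    rw [sub_div] at h1
    simp only [ha]
    linarith
  have hzero : η 0 = 0 := by
    refine le_antisymm ?_ (zero_le)
    rw [← NNReal.coe_le_coe]
    simpa [ha] using hηle 0 0
  have hstrict : StrictMono η := fun r r' hrr => by
    -- Lines of index at least `N` lie more than 1 above `η r`; the remaining ones have slope at
    -- least `1 / R N`. This uniform gain keeps the infimum strictly increasing.
    obtain ⟨N, hN⟩ := exists_nat_gt ((η r : ℝ) + 1)
    have hpos : 0 < ((r' : ℝ) - r) / R N := div_pos (sub_pos.2 (by exact_mod_cast hrr)) (hR0 N)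
    have h : (η r : ℝ) + min 1 (((r' : ℝ) - r) / R N) ≤ η r' := by
      refine hηge _ _ fun j => ?_
      rcases le_total N j with hj | hj
      · have h1 : (N : ℝ) ≤ j := by exact_mod_cast hj
        have h2 : 0 ≤ (r' : ℝ) / R j := div_nonneg r'.2 (hR0 j).le
        have h3 := min_le_left 1 (((r' : ℝ) - r) / R N)
        simp only [ha]
        linarith
      · have h1 := hηle r j
        have h2 : ((r' : ℝ) - r) / R N ≤ ((r' : ℝ) - r) / R j :=
          div_le_div_of_nonneg_left (sub_pos.2 (by exact_mod_cast hrr)).le (hR0 j) (hmono hj)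
        have h3 := min_le_right 1 (((r' : ℝ) - r) / R N)
        rw [sub_div _ _ (R j)] at h2
        simp only [ha] at h1 ⊢
        linarith
    rw [← NNReal.coe_lt_coe]
    have := lt_min one_pos hpos
    linarith
  have hcont : Continuous η := by
    refine LipschitzWith.continuous (K := 1) (LipschitzWith.of_dist_le_mul fun r r' => ?_)
    rw [NNReal.dist_eq, NNReal.dist_eq, NNReal.coe_one, one_mul, abs_le]
    have h1 := hlip r r'
    have h2 := hlip r' r
    rw [abs_sub_comm] at h2
    constructor <;> linarith
  refine ⟨η, ⟨⟨⟨hzero, hcont, fun s hs => ?_⟩, hstrict⟩, ?_⟩, hlip, hup, hlow⟩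
  · rw [← hzero]; exact hstrict hs
  · rintro ⟨b, hb⟩
    obtain ⟨k, hk⟩ := exists_nat_gt (b : ℝ)
    have h1 := hlow k (Real.toNNReal (R k)) (Real.coe_toNNReal _ (hR0 k).le).ge
    have h2 : (η (Real.toNNReal (R k)) : ℝ) ≤ b := by exact_mod_cast hb (mem_range_self _)
    linarith

theorem ClassKInfty.exists_rightInverse {η : ℝ≥0 → ℝ≥0} (h : ClassKInfty η) :
    ∃ χ : ℝ≥0 → ℝ≥0, ClassKInfty χ ∧ ∀ s, η (χ s) = s := by
  have hsurj : Function.Surjective η := fun s => by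
    obtain ⟨_, ⟨b, rfl⟩, hb⟩ := not_bddAbove_iff.1 h.unbounded s
    obtain ⟨c, -, hc⟩ := intermediate_value_Icc (zero_le) h.continuous.continuousOn
      ⟨by rw [h.map_zero]; exact zero_le, hb.le⟩
    exact ⟨c, hc⟩
  let e : ℝ≥0 ≃o ℝ≥0 := StrictMono.orderIsoOfSurjective η h.strictMono hsurj
  have he : ∀ s, η (e.symm s) = s := fun s => e.apply_symm_apply s
  have h0 : e.symm 0 = 0 := by
    apply h.strictMono.injective
    rw [he, h.map_zero]
  refine ⟨e.symm, ⟨⟨⟨h0, e.symm.continuous, fun s hs => ?_⟩, e.symm.strictMono⟩, ?_⟩, he⟩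
  · rw [← h0]; exact e.symm.strictMono hs
  · rw [e.symm.surjective.range_eq]
    exact not_bddAbove_univ

/-! ### Solutions with dominated inputs -/

/-- `ξ` solves `ẋ = f(x, u)` on `[0, t]` and `‖u‖ ≤ 1 + η(‖ξ‖)` almost everywhere on `[0, t]`. -/
structure IsDominatedSolution (f : StateSpace n → InputValue m → StateSpace n) (η : ℝ≥0 → ℝ≥0)
    (x : StateSpace n) (u : Input m) (t : ℝ) (ξ : ℝ → StateSpace n) : Prop where
  isSolutionUpTo : IsSolutionUpTo f x u t ξ
  ae_le : ∀ᵐ r ∂(volume.restrict (Icc (0 : ℝ) t)), ‖u r‖ ≤ 1 + η ‖ξ r‖₊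

theorem ae_restrict_Icc_mono {p : ℝ → Prop} {a b c d : ℝ} (hac : a ≤ c) (hdb : d ≤ b)
    (h : ∀ᵐ r ∂(volume.restrict (Icc a b)), p r) : ∀ᵐ r ∂(volume.restrict (Icc c d)), p r :=
  ae_restrict_of_ae_restrict_of_subset (Icc_subset_Icc hac hdb) h

theorem IsDominatedSolution.mono {f : StateSpace n → InputValue m → StateSpace n}
    (hf : Continuous (Function.uncurry f)) {η : ℝ≥0 → ℝ≥0} {x : StateSpace n} {u : Input m}
    {t s : ℝ} {ξ : ℝ → StateSpace n} (h : IsDominatedSolution f η x u t ξ) (hs : s ∈ Icc 0 t) :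
    IsDominatedSolution f η x u s ξ :=
  ⟨h.isSolutionUpTo.mono hf hs, ae_restrict_Icc_mono le_rfl hs.2 h.ae_le⟩

theorem IsDominatedSolution.exists_shift {f : StateSpace n → InputValue m → StateSpace n}
    (hf : Continuous (Function.uncurry f)) {η : ℝ≥0 → ℝ≥0} {x : StateSpace n} {u : Input m}
    {t s : ℝ} {ξ : ℝ → StateSpace n} (h : IsDominatedSolution f η x u (s + t) ξ) (hs : 0 ≤ s)
    (ht : 0 ≤ t) : ∃ v : Input m, IsDominatedSolution f η (ξ s) v t (fun r => ξ (s + r)) := by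
  obtain ⟨v, hv, -⟩ := _root_.exists_shift u hs
  have hv' := ae_restrict_Icc_of_ae_restrict_Ici hv le_rfl t
  refine ⟨v, h.isSolutionUpTo.shift hf hs ht hv', ?_⟩
  have h1 := h.ae_le
  rw [ae_restrict_iff' measurableSet_Icc] at h1 hv' ⊢
  have h2 := (measurePreserving_add_left (volume : Measure ℝ) s).quasiMeasurePreserving.ae h1
  filter_upwards [h2, hv'] with r hr1 hr2 hmem
  rw [hr2 hmem]
  exact hr1 ⟨add_nonneg hs hmem.1, by linarith [hmem.2]⟩

theorem IsDominatedSolution.exists_concat {f : StateSpace n → InputValue m → StateSpace n}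
    (hf : Continuous (Function.uncurry f)) {η : ℝ≥0 → ℝ≥0} {x : StateSpace n} {u v : Input m}
    {s t : ℝ} {ξ ζ : ℝ → StateSpace n} (hξ : IsDominatedSolution f η x u s ξ) (hs : 0 ≤ s)
    (ht : 0 ≤ t) (hζ : IsDominatedSolution f η (ξ s) v t ζ) :
    ∃ (w : Input m) (θ : ℝ → StateSpace n), IsDominatedSolution f η x w (s + t) θ ∧
      θ (s + t) = ζ t := by
  obtain ⟨w, hw, -⟩ := _root_.exists_concat u v (s := s) (c := max ‖u‖ ‖v‖) (le_max_left _ _)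
    (le_max_right _ _)
  refine ⟨w, _, ⟨hξ.isSolutionUpTo.concat hf hs ht hζ.isSolutionUpTo hw, ?_⟩, ?_⟩
  · have h1 := hξ.ae_le
    have h2 := hζ.ae_le
    rw [ae_restrict_iff' measurableSet_Icc] at h1 h2 ⊢
    rw [ae_restrict_iff' measurableSet_Ici] at hw
    have h3 := (measurePreserving_sub_right (volume : Measure ℝ) s).quasiMeasurePreserving.ae h2
    have hne : ∀ᵐ r : ℝ, r ≠ s := by simp [ae_iff]
    filter_upwards [h1, h3, hw, hne] with r hr1 hr3 hrw hrs hmem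
    rw [hrw hmem.1]
    rcases lt_or_gt_of_ne hrs with h | h
    · rw [if_pos h, if_pos h.le]
      exact hr1 ⟨hmem.1, h.le⟩
    · rw [if_neg h.not_gt, if_neg h.not_ge]
      exact hr3 ⟨by linarith, by linarith [hmem.2]⟩
  · split_ifs with h
    · have : t = 0 := by linarith
      subst this
      rw [add_zero, hζ.isSolutionUpTo.apply_zero le_rfl]
    · rw [add_sub_cancel_left]

theorem exists_input_Icc {w : ℝ → InputValue m} {t c : ℝ} (hc : 0 ≤ c)
    (hw : AEStronglyMeasurable w (volume.restrict (Icc (0 : ℝ) t)))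
    (hb : ∀ᵐ r ∂(volume.restrict (Icc (0 : ℝ) t)), ‖w r‖ ≤ c) :
    ∃ v : Input m, (∀ᵐ r ∂(volume.restrict (Icc (0 : ℝ) t)), v r = w r) ∧ ‖v‖ ≤ c := by
  obtain ⟨v, hv, hvn⟩ := exists_input (w := (Icc (0 : ℝ) t).indicator w) hc
    ((aestronglyMeasurable_indicator_iff measurableSet_Icc).2 hw).restrict (by
      rw [ae_restrict_iff' measurableSet_Icc] at hb
      refine ae_restrict_of_ae ?_
      filter_upwards [hb] with r hr
      by_cases h : r ∈ Icc (0 : ℝ) t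
      · rw [indicator_of_mem h]; exact hr h
      · rw [indicator_of_notMem h, norm_zero]; exact hc)
  refine ⟨v, ?_, hvn⟩
  filter_upwards [ae_restrict_Icc_of_ae_restrict_Ici hv le_rfl t,
    ae_restrict_mem measurableSet_Icc] with r hr hmem
  rw [hr, indicator_of_mem hmem]

/-- Until the sphere of radius `R (k + 1)` is hit, the input is bounded by `1 + (k + 2) ≤ R k`,
which is why the radii start at 3. The reachability bound then excludes a hit within unit time. -/
theorem IsDominatedSolution.norm_le_of_le_one {f : StateSpace n → InputValue m → StateSpace n}
    (hf : JointlyLipschitzOnBoundedSets f) {R : ℕ → ℝ} {η : ℝ≥0 → ℝ≥0}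
    (hR : ∀ k : ℕ, (k : ℝ) + 3 ≤ R k) (hR2 : ∀ k, 2 * R k ≤ R (k + 1))
    (hreach : ∀ (k : ℕ) (x : StateSpace n) (u : Input m) (t : ℝ), ‖x‖ < R k + 1 →
      ‖u‖ < R k + 1 → 0 ≤ t → t < 2 → ‖flow f t x u‖ < R (k + 1))
    (hη : ∀ (k : ℕ) (r : ℝ≥0), (r : ℝ) ≤ R k → (η r : ℝ) ≤ k + 1)
    {x : StateSpace n} {u : Input m} {t : ℝ} {ξ : ℝ → StateSpace n}
    (h : IsDominatedSolution f η x u t ξ) (ht0 : 0 ≤ t) (ht1 : t ≤ 1) {k : ℕ} (hx : ‖x‖ ≤ R k) :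
    ‖ξ t‖ ≤ R (k + 1) := by
  by_contra! hlt
  have hk0 : (0 : ℝ) ≤ k := Nat.cast_nonneg k
  obtain ⟨σ, hσ, hσR, hσle⟩ := exists_first_hit h.isSolutionUpTo.continuousOn
    (by rw [h.isSolutionUpTo.apply_zero ht0]; linarith [hR2 k, hR k]) ⟨ht0, le_rfl⟩ hlt.le
  have hb : ∀ᵐ r ∂(volume.restrict (Icc (0 : ℝ) σ)), ‖u r‖ ≤ R k := by
    filter_upwards [(h.mono hf.continuous hσ).ae_le, ae_restrict_mem measurableSet_Icc]
      with r hr hmem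
    have h1 := hη (k + 1) ‖ξ r‖₊ (hσle r hmem)
    push_cast at h1
    linarith [hR k]
  -- The essential bound holds only on `[0, σ]`, so the input is truncated to have small norm on the
  -- whole half-line.
  obtain ⟨v, hv, hvn⟩ := exists_input_Icc (by linarith [hR k])
    (Lp.stronglyMeasurable u).aestronglyMeasurable hb
  have hsol : IsSolutionUpTo f x v σ ξ :=
    (h.isSolutionUpTo.mono hf.continuous hσ).congr hf.continuous hσ.1 (by
      filter_upwards [hv] with r hr
      rw [hr])
  have := hreach k x v σ (by linarith) (by linarith) hσ.1 (by linarith [hσ.2])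
  rw [hsol.flow_eq hf ⟨hσ.1, le_rfl⟩, hσR] at this
  exact lt_irrefl _ this

theorem IsDominatedSolution.norm_le {f : StateSpace n → InputValue m → StateSpace n}
    (hf : JointlyLipschitzOnBoundedSets f) {R : ℕ → ℝ} {η : ℝ≥0 → ℝ≥0}
    (hR : ∀ k : ℕ, (k : ℝ) + 3 ≤ R k) (hR2 : ∀ k, 2 * R k ≤ R (k + 1))
    (hreach : ∀ (k : ℕ) (x : StateSpace n) (u : Input m) (t : ℝ), ‖x‖ < R k + 1 →
      ‖u‖ < R k + 1 → 0 ≤ t → t < 2 → ‖flow f t x u‖ < R (k + 1))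
    (hη : ∀ (k : ℕ) (r : ℝ≥0), (r : ℝ) ≤ R k → (η r : ℝ) ≤ k + 1)
    {x : StateSpace n} {u : Input m} {ξ : ℝ → StateSpace n} {k : ℕ} (hx : ‖x‖ ≤ R k) (N : ℕ)
    {t : ℝ} (h : IsDominatedSolution f η x u t ξ) (ht0 : 0 ≤ t) (htN : t ≤ N) :
    ‖ξ t‖ ≤ R (k + N) := by
  induction N generalizing t with
  | zero =>
    have : t = 0 := le_antisymm (by simpa using htN) ht0
    subst this
    rw [h.isSolutionUpTo.apply_zero le_rfl]
    exact hx
  | succ N ih =>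
    rcases le_total t N with htN' | hNt
    · have h1 := ih h ht0 htN'
      have h2 := hR2 (k + N)
      have h3 := hR (k + N)
      have h4 : (0 : ℝ) ≤ ((k + N : ℕ) : ℝ) := Nat.cast_nonneg _
      rw [← add_assoc]
      linarith
    · have hN0 : (0 : ℝ) ≤ N := Nat.cast_nonneg N
      have h1 := ih (h.mono hf.continuous ⟨hN0, hNt⟩) hN0 le_rfl
      have h' : IsDominatedSolution f η x u (N + (t - N)) ξ := by rwa [add_sub_cancel]
      obtain ⟨v, hv⟩ := h'.exists_shift hf.continuous hN0 (sub_nonneg.2 hNt)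
      have h2 := hv.norm_le_of_le_one hf hR hR2 hreach hη (sub_nonneg.2 hNt)
        (by push_cast at htN; linarith) h1
      simpa only [add_sub_cancel, add_assoc] using h2

theorem HasBRS.robustlyForwardCompleteTDI {f : StateSpace n → InputValue m → StateSpace n}
    (hf : JointlyLipschitzOnBoundedSets f) (h : HasBRS f) : RobustlyForwardCompleteTDI f := by
  obtain ⟨R, hR, hR2, hreach⟩ := h.exists_levels
  obtain ⟨η, hη, -, hup, -⟩ := exists_level_function hR hR2
  refine ⟨h.1, η, hη, fun C τ _ _ => ?_⟩
  obtain ⟨k, hk⟩ := exists_nat_ge C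
  obtain ⟨N, hN⟩ := exists_nat_ge τ
  refine ⟨R (k + N), ?_⟩
  rintro _ ⟨x, u, t, hx, hu, ht0, ht, rfl⟩
  refine IsDominatedSolution.norm_le hf hR hR2 hreach hup
    (ξ := fun s => flow f s x u) (by linarith [hR k]) N
    ⟨h.1.isSolutionUpTo hf x u ht0, ?_⟩ ht0 (by linarith)
  filter_upwards [ae_restrict_Icc_of_ae_restrict_Ici hu le_rfl t] with r hr
  have : ‖u r‖ ≤ η ‖flow f r x u‖₊ := hr
  linarith

/-- The level rises by at most one per unit of time. The constant 3 collects three roundings: of the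
initial level, of the time, and of `η` between levels. -/
theorem IsDominatedSolution.level_le {f : StateSpace n → InputValue m → StateSpace n}
    (hf : JointlyLipschitzOnBoundedSets f) {R : ℕ → ℝ} {η : ℝ≥0 → ℝ≥0}
    (hR : ∀ k : ℕ, (k : ℝ) + 3 ≤ R k) (hR2 : ∀ k, 2 * R k ≤ R (k + 1))
    (hreach : ∀ (k : ℕ) (x : StateSpace n) (u : Input m) (t : ℝ), ‖x‖ < R k + 1 →
      ‖u‖ < R k + 1 → 0 ≤ t → t < 2 → ‖flow f t x u‖ < R (k + 1))
    (hη : ∀ (k : ℕ) (r : ℝ≥0), (r : ℝ) ≤ R k → (η r : ℝ) ≤ k + 1)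
    (hη' : ∀ (k : ℕ) (r : ℝ≥0), R k ≤ r → (k : ℝ) ≤ η r)
    {x : StateSpace n} {u : Input m} {ξ : ℝ → StateSpace n} {t : ℝ}
    (h : IsDominatedSolution f η x u t ξ) (ht : 0 ≤ t) :
    (η ‖ξ t‖₊ : ℝ) ≤ η ‖x‖₊ + t + 3 := by
  classical
  have hex : ∃ k, ‖x‖ ≤ R k := by
    obtain ⟨k, hk⟩ := exists_nat_ge ‖x‖
    exact ⟨k, by linarith [hR k]⟩
  have hk : ((Nat.find hex : ℕ) : ℝ) ≤ η ‖x‖₊ + 1 := by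
    rcases Nat.eq_zero_or_pos (Nat.find hex) with h0 | h0
    · rw [h0, Nat.cast_zero]; positivity
    · have h1 := Nat.find_min hex (Nat.sub_lt h0 one_pos)
      have h2 := hη' (Nat.find hex - 1) ‖x‖₊ (not_le.1 h1).le
      have h3 : ((Nat.find hex : ℕ) : ℝ) ≤ ((Nat.find hex - 1 : ℕ) : ℝ) + 1 := by
        exact_mod_cast (by omega : Nat.find hex ≤ Nat.find hex - 1 + 1)
      linarith
  have h1 := h.norm_le hf hR hR2 hreach hη (Nat.find_spec hex) ⌈t⌉₊ ht (Nat.le_ceil t)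
  have h2 := hη _ ‖ξ t‖₊ h1
  have h3 := Nat.ceil_lt_add_one ht
  push_cast at h2
  linarith

end Levels

/-! ### Construction of a Lyapunov function -/

section Converse

variable {n m : ℕ}

/-- The right-hand side `f(x, (1 + η(‖x‖)) d)`, whose unit-bounded inputs `d` parametrize the
dominated inputs of `f`. -/
noncomputable def scaledRHS (f : StateSpace n → InputValue m → StateSpace n) (η : ℝ≥0 → ℝ≥0)
    (x : StateSpace n) (d : InputValue m) : StateSpace n :=
  f x ((1 + (η ‖x‖₊ : ℝ)) • d)

theorem level_sub_le {η : ℝ≥0 → ℝ≥0} (hη : ∀ r r', (η r : ℝ) ≤ η r' + |(r : ℝ) - r'|)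
    (x y : StateSpace n) : |(η ‖x‖₊ : ℝ) - η ‖y‖₊| ≤ ‖x - y‖ := by
  have h0 : |‖x‖ - ‖y‖| ≤ ‖x - y‖ := abs_norm_sub_norm_le x y
  have h1 := hη ‖x‖₊ ‖y‖₊
  have h2 := hη ‖y‖₊ ‖x‖₊
  rw [abs_sub_comm] at h2
  simp only [coe_nnnorm] at h1 h2
  rw [abs_le]
  constructor <;> linarith

/-- The 1-Lipschitz property of `η` makes the state-dependent scaling of the input harmless. With
it, one and the same `d` can drive dominated solutions from different initial states. -/
theorem JointlyLipschitzOnBoundedSets.scaledRHS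
    {f : StateSpace n → InputValue m → StateSpace n} (hf : JointlyLipschitzOnBoundedSets f)
    {η : ℝ≥0 → ℝ≥0} (hη0 : η 0 = 0) (hη : ∀ r r', (η r : ℝ) ≤ η r' + |(r : ℝ) - r'|) :
    JointlyLipschitzOnBoundedSets (scaledRHS f η) := by
  intro C hC
  have hlt : C ≤ (1 + C) * C := by nlinarith
  obtain ⟨L, hL, h⟩ := hf ((1 + C) * C) (by positivity)
  have hρ : ∀ x : StateSpace n, ‖x‖ < C → 1 + (η ‖x‖₊ : ℝ) < 1 + C := fun x hx => by
    have := level_sub_le hη x 0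
    rw [nnnorm_zero, hη0, NNReal.coe_zero, sub_zero, sub_zero] at this
    linarith [(abs_le.1 this).2]
  have hρ0 : ∀ x : StateSpace n, 0 < 1 + (η ‖x‖₊ : ℝ) := fun x => by positivity
  have hv : ∀ (x : StateSpace n) (d : InputValue m), ‖x‖ < C → ‖d‖ < C →
      ‖(1 + (η ‖x‖₊ : ℝ)) • d‖ < (1 + C) * C := fun x d hx hd => by
    rw [norm_smul, Real.norm_of_nonneg (hρ0 x).le]
    exact mul_lt_mul'' (hρ x hx) hd (hρ0 x).le (norm_nonneg _)
  refine ⟨L * (1 + (1 + C)), by positivity, fun x₁ x₂ d₁ d₂ hx₁ hx₂ hd₁ hd₂ => ?_⟩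
  refine (h x₁ x₂ _ _ (hx₁.trans_le hlt) (hx₂.trans_le hlt) (hv x₁ d₁ hx₁ hd₁)
    (hv x₂ d₂ hx₂ hd₂)).trans ?_
  have e : (1 + (η ‖x₁‖₊ : ℝ)) • d₁ - (1 + (η ‖x₂‖₊ : ℝ)) • d₂
      = ((η ‖x₁‖₊ : ℝ) - η ‖x₂‖₊) • d₁ + (1 + (η ‖x₂‖₊ : ℝ)) • (d₁ - d₂) := by
    module
  have h1 : ‖((η ‖x₁‖₊ : ℝ) - η ‖x₂‖₊) • d₁‖ ≤ ‖x₁ - x₂‖ * C := by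
    rw [norm_smul]
    exact mul_le_mul (level_sub_le hη x₁ x₂) hd₁.le (norm_nonneg _) (norm_nonneg _)
  have h2 : ‖(1 + (η ‖x₂‖₊ : ℝ)) • (d₁ - d₂)‖ ≤ (1 + C) * ‖d₁ - d₂‖ := by
    rw [norm_smul, Real.norm_of_nonneg (hρ0 x₂).le]
    exact mul_le_mul_of_nonneg_right (hρ x₂ hx₂).le (norm_nonneg _)
  have h3 := norm_add_le (((η ‖x₁‖₊ : ℝ) - η ‖x₂‖₊) • d₁)
    ((1 + (η ‖x₂‖₊ : ℝ)) • (d₁ - d₂))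
  rw [← e] at h3
  rw [mul_assoc]
  refine mul_le_mul_of_nonneg_left ?_ hL.le
  nlinarith [norm_nonneg (d₁ - d₂), norm_nonneg (x₁ - x₂)]

theorem continuousOn_level {η : ℝ≥0 → ℝ≥0} (hη : Continuous η) {ξ : ℝ → StateSpace n}
    {s : Set ℝ} (hξ : ContinuousOn ξ s) : ContinuousOn (fun r => 1 + (η ‖ξ r‖₊ : ℝ)) s :=
  continuousOn_const.add
    ((NNReal.continuous_coe.comp hη).comp_continuousOn hξ.nnnorm)

theorem IsDominatedSolution.exists_scaled {f : StateSpace n → InputValue m → StateSpace n}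
    {η : ℝ≥0 → ℝ≥0} (hg : Continuous (Function.uncurry (scaledRHS f η)))
    (hη : Continuous η) {x : StateSpace n} {u : Input m}
    {t : ℝ} {ξ : ℝ → StateSpace n} (ht : 0 ≤ t) (h : IsDominatedSolution f η x u t ξ) :
    ∃ d : Input m, ‖d‖ ≤ 1 ∧ IsSolutionUpTo (scaledRHS f η) x d t ξ := by
  have hρ0 : ∀ r, 0 < 1 + (η ‖ξ r‖₊ : ℝ) := fun r => by positivity
  have hmeas : AEStronglyMeasurable (fun r => (1 + (η ‖ξ r‖₊ : ℝ))⁻¹ • u r)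
      (volume.restrict (Icc 0 t)) :=
    (((continuousOn_level hη h.isSolutionUpTo.continuousOn).inv₀
      fun r _ => (hρ0 r).ne').aestronglyMeasurable measurableSet_Icc).smul
      (Lp.stronglyMeasurable u).aestronglyMeasurable
  obtain ⟨d, hd, hdn⟩ := exists_input_Icc zero_le_one hmeas (by
    filter_upwards [h.ae_le] with r hr
    rw [norm_smul, norm_inv, Real.norm_of_nonneg (hρ0 r).le, inv_mul_le_iff₀ (hρ0 r), mul_one]
    exact hr)
  refine ⟨d, hdn, h.isSolutionUpTo.congr hg ht ?_⟩
  filter_upwards [hd] with r hr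
  rw [hr, scaledRHS, smul_inv_smul₀ (hρ0 r).ne']

theorem exists_isDominatedSolution_of_scaled
    {f : StateSpace n → InputValue m → StateSpace n}
    (hf : Continuous (Function.uncurry f)) {η : ℝ≥0 → ℝ≥0} (hη : Continuous η)
    {x : StateSpace n} {d : Input m} {t : ℝ} {ξ : ℝ → StateSpace n} (ht : 0 ≤ t)
    (hd : ‖d‖ ≤ 1) (h : IsSolutionUpTo (scaledRHS f η) x d t ξ) :
    ∃ u : Input m, IsDominatedSolution f η x u t ξ := by
  have hρ0 : ∀ r, 0 < 1 + (η ‖ξ r‖₊ : ℝ) := fun r => by positivity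
  have hcont := continuousOn_level hη h.continuousOn
  have hmeas : AEStronglyMeasurable (fun r => (1 + (η ‖ξ r‖₊ : ℝ)) • d r)
      (volume.restrict (Icc 0 t)) :=
    (hcont.aestronglyMeasurable measurableSet_Icc).smul
      (Lp.stronglyMeasurable d).aestronglyMeasurable
  obtain ⟨B, hB⟩ := isCompact_Icc.exists_bound_of_continuousOn hcont
  have hle : ∀ᵐ r ∂(volume.restrict (Icc (0 : ℝ) t)),
      ‖(1 + (η ‖ξ r‖₊ : ℝ)) • d r‖ ≤ 1 + (η ‖ξ r‖₊ : ℝ) := by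
    filter_upwards [ae_restrict_Icc_of_ae_restrict_Ici (ae_norm_le_norm_input d) le_rfl t]
      with r hr
    rw [norm_smul, Real.norm_of_nonneg (hρ0 r).le]
    exact mul_le_of_le_one_right (hρ0 r).le (hr.trans hd)
  obtain ⟨u, hu, -⟩ := exists_input_Icc
    ((norm_nonneg _).trans (hB 0 ⟨le_rfl, ht⟩)) hmeas (by
      filter_upwards [hle, ae_restrict_mem measurableSet_Icc] with r hr hmem
      exact hr.trans ((le_abs_self _).trans (hB r hmem)))
  refine ⟨u, h.congr hf ht ?_, ?_⟩
  · filter_upwards [hu] with r hr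
    rw [hr, scaledRHS]
  · filter_upwards [hu, hle] with r hr hr'
    rwa [hr]

/-- The values `η(‖ξ(t)‖) - 2 t` along dominated solutions starting at `x`. -/
def dominatedValues (f : StateSpace n → InputValue m → StateSpace n) (η : ℝ≥0 → ℝ≥0)
    (x : StateSpace n) : Set ℝ :=
  {a | ∃ (u : Input m) (t : ℝ) (ξ : ℝ → StateSpace n), 0 ≤ t ∧
    IsDominatedSolution f η x u t ξ ∧ a = η ‖ξ t‖₊ - 2 * t}

theorem level_mem_dominatedValues {f : StateSpace n → InputValue m → StateSpace n}
    (hf : Continuous (Function.uncurry f)) (η : ℝ≥0 → ℝ≥0) (x : StateSpace n) :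
    (η ‖x‖₊ : ℝ) ∈ dominatedValues f η x := by
  refine ⟨0, 0, fun _ => x, le_rfl, ⟨isSolutionUpTo_mk hf le_rfl continuousOn_const ?_, ?_⟩,
    by simp⟩
  · intro s hs
    have : s = 0 := le_antisymm hs.2 hs.1
    subst this
    simp
  · rw [Icc_self, Measure.restrict_singleton]
    simp

theorem bddAbove_dominatedValues {f : StateSpace n → InputValue m → StateSpace n}
    {η : ℝ≥0 → ℝ≥0}
    (hlevel : ∀ (x : StateSpace n) (u : Input m) (t : ℝ) (ξ : ℝ → StateSpace n), 0 ≤ t →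
      IsDominatedSolution f η x u t ξ → (η ‖ξ t‖₊ : ℝ) ≤ η ‖x‖₊ + t + 3) (x : StateSpace n) :
    (η ‖x‖₊ : ℝ) + 3 ∈ upperBounds (dominatedValues f η x) := by
  rintro _ ⟨u, t, ξ, ht, h, rfl⟩
  linarith [hlevel x u t ξ ht h]

/-- Dynamic programming: a competitor from `ξ s`, prefixed by `ξ` on `[0, s]`, competes from `x` at
the cost `2 s`. -/
theorem sSup_dominatedValues_le_add {f : StateSpace n → InputValue m → StateSpace n}
    (hf : Continuous (Function.uncurry f)) {η : ℝ≥0 → ℝ≥0}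
    (hlevel : ∀ (x : StateSpace n) (u : Input m) (t : ℝ) (ξ : ℝ → StateSpace n), 0 ≤ t →
      IsDominatedSolution f η x u t ξ → (η ‖ξ t‖₊ : ℝ) ≤ η ‖x‖₊ + t + 3)
    {x : StateSpace n} {u : Input m} {s : ℝ} {ξ : ℝ → StateSpace n} (hs : 0 ≤ s)
    (h : IsDominatedSolution f η x u s ξ) :
    sSup (dominatedValues f η (ξ s)) ≤ sSup (dominatedValues f η x) + 2 * s := by
  refine csSup_le ⟨_, level_mem_dominatedValues hf η _⟩ ?_
  rintro _ ⟨v, t, ζ, ht, hζ, rfl⟩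
  obtain ⟨w, θ, hθ, hθt⟩ := h.exists_concat hf hs ht hζ
  have := le_csSup ⟨_, bddAbove_dominatedValues hlevel x⟩
    (show (η ‖θ (s + t)‖₊ : ℝ) - 2 * (s + t) ∈ dominatedValues f η x from
      ⟨w, s + t, θ, add_nonneg hs ht, hθ, rfl⟩)
  rw [hθt] at this
  linarith

/-- A nearly optimal solution from `x` is compared with the one from `y` having the same normalized
input. Only times up to 3 count, so one Lipschitz constant on one ball suffices. -/
theorem exists_lipschitz_sSup_dominatedValues
    {f : StateSpace n → InputValue m → StateSpace n}
    (hf : JointlyLipschitzOnBoundedSets f) {R : ℕ → ℝ} {η : ℝ≥0 → ℝ≥0}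
    (hη0 : η 0 = 0) (hηc : Continuous η) (hη : ∀ r r', (η r : ℝ) ≤ η r' + |(r : ℝ) - r'|)
    (hR : ∀ k : ℕ, (k : ℝ) + 3 ≤ R k)
    (hbound : ∀ (k : ℕ) (x : StateSpace n) (u : Input m) (t : ℝ) (ξ : ℝ → StateSpace n),
      ‖x‖ ≤ R k → 0 ≤ t → t ≤ 3 → IsDominatedSolution f η x u t ξ → ‖ξ t‖ ≤ R (k + 3))
    (hlevel : ∀ (x : StateSpace n) (u : Input m) (t : ℝ) (ξ : ℝ → StateSpace n), 0 ≤ t →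
      IsDominatedSolution f η x u t ξ → (η ‖ξ t‖₊ : ℝ) ≤ η ‖x‖₊ + t + 3) (C : ℝ) :
    ∃ L : ℝ, 0 < L ∧ ∀ x y : StateSpace n, ‖x‖ < C → ‖y‖ < C →
      sSup (dominatedValues f η x) ≤ sSup (dominatedValues f η y) + L * ‖x - y‖ := by
  have hg := hf.scaledRHS hη0 hη
  obtain ⟨k, hk⟩ := exists_nat_ge C
  obtain ⟨L, hL, hLip⟩ := hg.lipschitz_state (R (k + 3)) 1
  refine ⟨Real.exp (L * 3), Real.exp_pos _, fun x y hx hy => ?_⟩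
  have hxR : ‖x‖ ≤ R k := by linarith [hR k]
  have hyR : ‖y‖ ≤ R k := by linarith [hR k]
  have hexp : 1 ≤ Real.exp (L * 3) := Real.one_le_exp (by positivity)
  have hsub : ∀ a b : StateSpace n, (η ‖a‖₊ : ℝ) ≤ η ‖b‖₊ + ‖a - b‖ := fun a b => by
    linarith [(abs_le.1 (level_sub_le hη a b)).2]
  refine csSup_le ⟨_, level_mem_dominatedValues hf.continuous η _⟩ ?_
  rintro _ ⟨u, t, ξ, ht, hξ, rfl⟩
  have hbdd : BddAbove (dominatedValues f η y) := ⟨_, bddAbove_dominatedValues hlevel y⟩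
  rcases le_total 3 t with h3 | h3
  · have h1 := hlevel x u t ξ ht hξ
    have h2 := hsub x y
    have h4 := le_csSup hbdd (level_mem_dominatedValues hf.continuous η y)
    have h5 := le_mul_of_one_le_left (norm_nonneg (x - y)) hexp
    linarith
  · obtain ⟨d, hd, hξg⟩ := hξ.exists_scaled hg.continuous hηc ht
    have hgb : ∀ (z : StateSpace n) (ζ : ℝ → StateSpace n), ‖z‖ ≤ R k → ∀ s ∈ Icc 0 t,
        IsSolutionUpTo (scaledRHS f η) z d s ζ → ‖ζ s‖ ≤ R (k + 3) := fun z ζ hz s hs hζ => by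
      obtain ⟨v, hv⟩ := exists_isDominatedSolution_of_scaled hf.continuous hηc hs.1 hd hζ
      exact hbound k z v s ζ hz hs.1 (hs.2.trans h3) hv
    obtain ⟨ζ, hζ⟩ := exists_isSolutionUpTo_of_bound hg y d ht
      fun s hs ζ hζ => hgb y ζ hyR s hs hζ
    have hdist := hξg.norm_sub_le hg.continuous hL.le hζ (fun r hr v hv =>
      hLip _ _ v (hgb x ξ hxR r hr (hξg.mono hg.continuous hr))
        (hgb y ζ hyR r hr (hζ.mono hg.continuous hr)) (hv.trans hd)) t ⟨ht, le_rfl⟩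
    obtain ⟨v, hv⟩ := exists_isDominatedSolution_of_scaled hf.continuous hηc ht hd hζ
    have h1 := le_csSup hbdd (show (η ‖ζ t‖₊ : ℝ) - 2 * t ∈ dominatedValues f η y from
      ⟨v, t, ζ, ht, hv, rfl⟩)
    have h2 := hsub (ξ t) (ζ t)
    have h4 : ‖x - y‖ * Real.exp (L * t) ≤ Real.exp (L * 3) * ‖x - y‖ := by
      rw [mul_comm]
      exact mul_le_mul_of_nonneg_right
        (Real.exp_le_exp.2 (mul_le_mul_of_nonneg_left h3 hL.le)) (norm_nonneg _)
    linarith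

theorem LipschitzOnBoundedSets.continuous {V : StateSpace n → ℝ≥0}
    (hV : LipschitzOnBoundedSets V) : Continuous V := by
  rw [continuous_iff_continuousAt]
  intro x
  obtain ⟨L, hL, h⟩ := hV (‖x‖ + 1) (by positivity)
  have hlim : Tendsto (fun y => L * ‖y - x‖) (𝓝 x) (𝓝 0) := by
    have : Continuous (fun y => L * ‖y - x‖) := by fun_prop
    simpa using this.tendsto x
  rw [ContinuousAt, ← NNReal.tendsto_coe, tendsto_iff_norm_sub_tendsto_zero]
  refine squeeze_zero' (Eventually.of_forall fun _ => norm_nonneg _) ?_ hlim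
  filter_upwards [(continuous_norm.tendsto x).eventually_lt_const (lt_add_one ‖x‖)] with y hy
  exact h y x hy (lt_add_one _)

/-- Inputs bounded by `η(‖x‖)` are dominated for a short time. -/
theorem ForwardComplete.eventually_isDominatedSolution
    {f : StateSpace n → InputValue m → StateSpace n} (hf : JointlyLipschitzOnBoundedSets f)
    (hc : ForwardComplete f) {η : ℝ≥0 → ℝ≥0} (hη : Continuous η) {x : StateSpace n}
    {u : Input m} (hu : ‖u‖ ≤ η ‖x‖₊) :
    ∀ᶠ s in 𝓝[>] (0 : ℝ), IsDominatedSolution f η x u s (fun r => flow f r x u) := by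
  have hsol := hc.isSolutionUpTo hf x u zero_le_one
  have hcont := (continuousOn_level hη hsol.continuousOn) 0 ⟨le_rfl, zero_le_one⟩
  -- The summand 1 in the domination bound gives strict slack at time 0, hence domination for a
  -- short time by continuity.
  have hev := hcont.eventually_const_lt (u := ‖u‖) (by
    simp only [flow_zero hf hc]; linarith)
  obtain ⟨ε, hε, hball⟩ := Metric.mem_nhdsWithin_iff.1 hev
  filter_upwards [Ioo_mem_nhdsGT (lt_min hε one_pos)] with s hs
  have hsε := hs.2.trans_le (min_le_left _ _)
  have hs1 := hs.2.trans_le (min_le_right _ _)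
  refine ⟨hsol.mono hf.continuous ⟨hs.1.le, hs1.le⟩, ?_⟩
  filter_upwards [ae_restrict_Icc_of_ae_restrict_Ici (ae_norm_le_norm_input u) le_rfl s,
    ae_restrict_mem measurableSet_Icc] with r hr hmem
  refine hr.trans (le_of_lt (hball ⟨?_, hmem.1, hmem.2.trans hs1.le⟩))
  rw [Metric.mem_ball, Real.dist_eq, sub_zero, abs_of_nonneg hmem.1]
  exact hmem.2.trans_lt hsε

theorem HasBRS.exists_lyapunovFunction {f : StateSpace n → InputValue m → StateSpace n}
    (hf : JointlyLipschitzOnBoundedSets f) (h : HasBRS f) :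
    ∃ V : StateSpace n → ℝ≥0, IsBRSLyapunovFunction f V ∧ LipschitzOnBoundedSets V := by
  obtain ⟨R, hR, hR2, hreach⟩ := h.exists_levels
  obtain ⟨η, hη, hlip, hup, hlow⟩ := exists_level_function hR hR2
  have hlevel : ∀ (x : StateSpace n) (u : Input m) (t : ℝ) (ξ : ℝ → StateSpace n), 0 ≤ t →
      IsDominatedSolution f η x u t ξ → (η ‖ξ t‖₊ : ℝ) ≤ η ‖x‖₊ + t + 3 :=
    fun x u t ξ ht hξ => hξ.level_le hf hR hR2 hreach hup hlow ht
  have hbound : ∀ (k : ℕ) (x : StateSpace n) (u : Input m) (t : ℝ) (ξ : ℝ → StateSpace n),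
      ‖x‖ ≤ R k → 0 ≤ t → t ≤ 3 → IsDominatedSolution f η x u t ξ → ‖ξ t‖ ≤ R (k + 3) :=
    fun k x u t ξ hx ht ht3 hξ =>
      hξ.norm_le hf hR hR2 hreach hup hx 3 ht (by exact_mod_cast ht3)
  set W : StateSpace n → ℝ := fun x => sSup (dominatedValues f η x) with hW
  have hWge : ∀ x, (η ‖x‖₊ : ℝ) ≤ W x := fun x =>
    le_csSup ⟨_, bddAbove_dominatedValues hlevel x⟩
      (level_mem_dominatedValues hf.continuous η x)
  have hWle : ∀ x, W x ≤ η ‖x‖₊ + 3 := fun x =>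
    csSup_le ⟨_, level_mem_dominatedValues hf.continuous η x⟩ (bddAbove_dominatedValues hlevel x)
  have hW0 : ∀ x, 0 ≤ 2 + W x := fun x =>
    add_nonneg zero_le_two ((η ‖x‖₊).2.trans (hWge x))
  -- The added 2 dominates the growth rate 2 of `W`, so the Lie derivative is at most `V` even where
  -- `W` is small.
  set V : StateSpace n → ℝ≥0 := fun x => ⟨2 + W x, hW0 x⟩ with hV
  have hVW : ∀ x, (V x : ℝ) = 2 + W x := fun x => rfl
  have hVlip : LipschitzOnBoundedSets V := fun C _ => by
    obtain ⟨L, hL, hLW⟩ := exists_lipschitz_sSup_dominatedValues hf hη.map_zero hη.continuous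
      hlip hR hbound hlevel C
    refine ⟨L, hL, fun x y hx hy => ?_⟩
    have h1 := hLW x y hx hy
    have h2 := hLW y x hy hx
    rw [norm_sub_rev] at h2
    rw [hVW, hVW, abs_le]
    constructor <;> linarith
  -- With `η ∘ χ = id`, the condition `χ(‖u‖) ≤ ‖x‖` turns into `‖u‖ ≤ η(‖x‖)`.
  obtain ⟨χ, hχ, hηχ⟩ := hη.exists_rightInverse
  refine ⟨V, ⟨hVlip.continuous, ⟨η, η, hη, hη, 5, fun x => ⟨?_, ?_⟩⟩, χ, hχ, fun x u hu => ?_⟩,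
    hVlip⟩
  · rw [← NNReal.coe_le_coe, hVW]
    linarith [hWge x]
  · rw [← NNReal.coe_le_coe, hVW]
    push_cast
    linarith [hWle x]
  · have hux : ‖u‖ ≤ η ‖x‖₊ := by
      have := hη.strictMono.monotone hu
      rw [hηχ] at this
      exact_mod_cast this
    refine limsup_le_of_le ?_ ?_
    · exact isCobounded_le_of_bot
    · filter_upwards [h.1.eventually_isDominatedSolution hf hη.continuous hux,
        self_mem_nhdsWithin] with s hs hs0
      rw [EReal.coe_le_coe_iff]
      have hs0' : 0 < s := hs0
      have h1 := sSup_dominatedValues_le_add hf.continuous hlevel hs0'.le hs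
      have h2 : ((V (flow f s x u) : ℝ) - V x) / s ≤ 2 := by
        rw [div_le_iff₀ hs0', hVW, hVW]
        simp only [hW]
        linarith
      have h3 : 0 ≤ W x := (η ‖x‖₊).2.trans (hWge x)
      have h4 := hVW x
      linarith

end Converse

/-! ### The equivalence. -/

theorem mainTheorem2 {n m : ℕ} (f : StateSpace n → InputValue m → StateSpace n)
    (hf : JointlyLipschitzOnBoundedSets f) :
    List.TFAE [
      ForwardComplete f,
      HasBRS f,
      ∃ V : StateSpace n → ℝ≥0, IsBRSLyapunovFunction f V,
      ∃ V : StateSpace n → ℝ≥0, IsBRSLyapunovFunction f V ∧ LipschitzOnBoundedSets V,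
      RobustlyForwardCompleteTDI f] := by
  tfae_have 1 → 2 := fun h => h.hasBRS hf
  tfae_have 2 → 4 := fun h => h.exists_lyapunovFunction hf
  tfae_have 4 → 3 := fun ⟨V, hV, _⟩ => ⟨V, hV⟩
  tfae_have 3 → 1 := fun ⟨_, hV⟩ => hV.forwardComplete hf
  tfae_have 2 → 5 := fun h => h.robustlyForwardCompleteTDI hf
  tfae_have 5 → 1 := fun h => h.1
  tfae_finish
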